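/- Let $M$ be a smooth Riemannian manifold (Hausdorff, second countable, without boundary, of dimension $n+1\ge 1$; neither completeness nor connectedness is assumed). Its fundamental tone is $$\lambda^*(M)=\inf\left\{\frac{\int_M|\nabla f|^2}{\int_M f^2}\;:\; f\in H_0^1(M)\setminus\{0\}\right\},$$ where $H_0^1(M)$ is the completion of $C_0^\infty(M)$, the smooth functions with compact support, with respect to the norm $\|\varphi\|^2=\int_M\varphi^2+\int_M|\nabla\varphi|^2$, and the integrals are taken with respect to the Riemannian measure. Let $\mathcal F$ be a codimension-one foliation of class $C^2$ of $M$ that is transversely oriented by a continuous unit vector field $\eta$ on $M$ normal to the leaves. For a leaf $F\in\mathcal F$ and $x\in F$ let $H_F(x)$ be the mean curvature of $F$ at $x$ with respect to $\eta$, i.e. the trace of the shape operator $v\mapsto-(\nabla_v\eta)^{\top}$ of $T_xF$, where $\nabla$ is the Levi-Civita connection of $M$ and $\top$ is the orthogonal projection onto $T_xF$. Suppose that $\lambda^*(M)=0$ and that all leaves have the same constant mean curvature: there is $H\in\mathbb R$ with $H_F(x)=H$ for every leaf $F\in\mathcal F$ and every $x\in F$. Then every leaf of $\mathcal F$ is minimal,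 i.e. $H_F(x)=0$ for every leaf $F\in\mathcal F$ and every $x\in F$. -/

import Mathlib

open MeasureTheory Filter Topology Manifold Bundle
open scoped ContDiff ENNReal

noncomputable section

namespace FoliatedRiemannian

/-- The model space `ℝᵈ` with its Euclidean structure. -/
abbrev Model (d : ℕ) : Type := EuclideanSpace ℝ (Fin d)

/-! ### Riemannian geometry in the coordinates of the preferred charts -/

section Riemannian

variable {d : ℕ} {M : Type*} [TopologicalSpace M] [ChartedSpace (Model d) M]
  [IsManifold (𝓡 d) ∞ M]

/-- The coordinate frame at `q` of the chart `φ` centred at `p`: the linear map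
`dφ⁻¹ : ℝᵈ → T_q M` (for `q` in the domain of `φ`). -/
def frame (p q : M) : Model d →L[ℝ] TangentSpace (𝓡 d) q :=
  (trivializationAt (Model d) (TangentSpace (𝓡 d)) p).symmL ℝ q

/-- The components at `q` of tangent vectors in the chart `φ` centred at `p`: the linear map
`dφ : T_q M → ℝᵈ` (for `q` in the domain of `φ`). -/
def coords (p q : M) : TangentSpace (𝓡 d) q →L[ℝ] Model d :=
  (trivializationAt (Model d) (TangentSpace (𝓡 d)) p).continuousLinearMapAt ℝ q

variable [RiemannianBundle (fun x : M => TangentSpace (𝓡 d) x)]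

/-- The matrix `(g_ij)` of the metric in the chart `φ` centred at `p`, as a function of the
coordinates `y = φ(q)`: `g_ij(y) = ⟨∂_i, ∂_j⟩` at `q = φ⁻¹(y)`. -/
def metricMatrix (p : M) (y : Model d) : Matrix (Fin d) (Fin d) ℝ :=
  Matrix.of fun i j =>
    inner ℝ (frame p ((chartAt (Model d) p).symm y) (EuclideanSpace.single i 1))
      (frame p ((chartAt (Model d) p).symm y) (EuclideanSpace.single j 1))

/-- The partial derivative `∂_k g_ij` in the chart centred at `p`. -/
def metricPartial (p : M) (y : Model d) (k i j : Fin d) : ℝ :=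
  fderiv ℝ (fun z => metricMatrix p z i j) y (EuclideanSpace.single k 1)

/-- The Christoffel symbols
`Γᵏ_ij = ½ ∑_l gᵏˡ (∂_i g_jl + ∂_j g_il - ∂_l g_ij)` in the chart centred at `p`. -/
def christoffel (p : M) (y : Model d) (k i j : Fin d) : ℝ :=
  (1 / 2 : ℝ) * ∑ l, (metricMatrix p y)⁻¹ k l *
    (metricPartial p y i j l + metricPartial p y j i l - metricPartial p y l i j)

/-- The components of the vector field `X` in the chart centred at `p`, as a function of the
coordinates. -/
def fieldInChart (X : Π q : M, TangentSpace (𝓡 d) q) (p : M) (y : Model d) : Model d :=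
  coords p ((chartAt (Model d) p).symm y) (X ((chartAt (Model d) p).symm y))

/-- The covariant derivative of `X` in the coordinates of the chart centred at `p`: the linear map
with components `(∇_u X)ᵏ = dXᵏ(u) + ∑_{i,j} Γᵏ_ij uⁱ Xʲ`. -/
def covariantInChart (X : Π q : M, TangentSpace (𝓡 d) q) (p : M) (y : Model d) :
    Model d →L[ℝ] Model d :=
  fderiv ℝ (fieldInChart X p) y +
    ∑ k, ∑ i, ∑ j, (christoffel p y k i j * fieldInChart X p y j) •
      (EuclideanSpace.proj (𝕜 := ℝ) i).smulRight (EuclideanSpace.single k (1 : ℝ) : Model d)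

/-- The Levi-Civita covariant derivative `v ↦ ∇_v X` of a vector field `X` at `p`, computed in the
chart centred at `p`. -/
def leviCivita (X : Π q : M, TangentSpace (𝓡 d) q) (p : M) :
    TangentSpace (𝓡 d) p →L[ℝ] TangentSpace (𝓡 d) p :=
  frame p p ∘L covariantInChart X p (chartAt (Model d) p p) ∘L coords p p

variable [MeasurableSpace M]

/-- The Riemannian measure `√(det g_ij) dy` of the domain of the chart centred at `p`, extended by
zero to `M`. -/
def chartVolume (p : M) : Measure M :=
  Measure.map (chartAt (Model d) p).symm
    ((volume.restrict (chartAt (Model d) p).target).withDensity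
      fun y => ENNReal.ofReal (Real.sqrt (metricMatrix p y).det))

variable (d M) in
/-- The Riemannian measure of `M`: the least measure that dominates `√(det g_ij) dy` on the domain
of each chart. As these local measures agree on overlaps and countably many charts cover a
second countable manifold, it restricts to `√(det g_ij) dy` on the domain of each chart. -/
def riemannianVolume : Measure M := ⨆ p : M, chartVolume (d := d) p

/-- The gradient of a function: `⟨∇φ, v⟩ = dφ(v)`. -/
def grad (φ : M → ℝ) (x : M) : TangentSpace (𝓡 d) x :=
  haveI : FiniteDimensional ℝ (TangentSpace (𝓡 d) x) :=
    inferInstanceAs (FiniteDimensional ℝ (Model d))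
  haveI : CompleteSpace (TangentSpace (𝓡 d) x) := FiniteDimensional.complete ℝ _
  (InnerProductSpace.toDual ℝ (TangentSpace (𝓡 d) x)).symm
    (mfderiv (𝓡 d) 𝓘(ℝ, ℝ) φ x : TangentSpace (𝓡 d) x →L[ℝ] ℝ)

variable (d) in
/-- The test functions `C₀^∞(M)`: smooth functions with compact support. -/
def IsTestFunction (φ : M → ℝ) : Prop :=
  ContMDiff (𝓡 d) 𝓘(ℝ, ℝ) ∞ φ ∧ HasCompactSupport φ

variable (d) in
/-- `f` belongs to the Sobolev space `H₀¹(M)` and its Dirichlet energy `∫ |∇f|²` is `D`.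
The completion of `C₀^∞(M)` for the norm `(∫ φ² + ∫ |∇φ|²)^{1/2}` is realised inside `L²(M)`:
`f` is the `L²`-limit of test functions `φ_k` which form a Cauchy sequence for the norm, and
`∫ |∇f|² = lim ∫ |∇φ_k|²`. -/
def IsSobolevWithEnergy (f : M → ℝ) (D : ℝ≥0∞) : Prop :=
  MemLp f 2 (riemannianVolume d M) ∧
  ∃ φ : ℕ → M → ℝ, (∀ k, IsTestFunction d (φ k)) ∧
    Tendsto (fun k => ∫⁻ x, ‖φ k x - f x‖ₑ ^ 2 ∂(riemannianVolume d M)) atTop (𝓝 0) ∧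
    Tendsto (fun kl : ℕ × ℕ => ∫⁻ x,
      ‖grad (d := d) (φ kl.1) x - grad (d := d) (φ kl.2) x‖ₑ ^ 2
        ∂(riemannianVolume d M)) atTop (𝓝 0) ∧
    Tendsto (fun k => ∫⁻ x, ‖grad (d := d) (φ k) x‖ₑ ^ 2 ∂(riemannianVolume d M))
      atTop (𝓝 D)

variable (d M) in
/-- The fundamental tone `λ*(M) = inf { ∫ |∇f|² / ∫ f² : f ∈ H₀¹(M), f ≠ 0 }`. -/
def fundamentalTone : ℝ≥0∞ :=
  ⨅ (f : M → ℝ) (D : ℝ≥0∞) (_ : IsSobolevWithEnergy d f D)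
    (_ : ¬ f =ᵐ[riemannianVolume d M] 0),
      D / ∫⁻ x, ‖f x‖ₑ ^ 2 ∂(riemannianVolume d M)

end Riemannian

/-! ### Codimension-one foliations -/

/-- A codimension-one foliation of class `C²` of an `(n+1)`-dimensional manifold: an atlas of
`C²`-charts `e = (x₁, …, xₙ, t)` whose changes of charts have locally the form
`(x, t) ↦ (f(x, t), h(t))`, i.e. locally the transverse (last) coordinate of one chart depends only
on the transverse coordinate of the other. -/
structure Foliation (n : ℕ) (M : Type*) [TopologicalSpace M] [ChartedSpace (Model (n + 1)) M] where
  /-- the foliation charts -/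
  atlas : Set (OpenPartialHomeomorph M (Model (n + 1)))
  atlas_subset : atlas ⊆ IsManifold.maximalAtlas (𝓡 (n + 1)) 2 M
  cover : ∀ x : M, ∃ e ∈ atlas, x ∈ e.source
  compatible : ∀ e ∈ atlas, ∀ e' ∈ atlas, ∀ x ∈ e.source ∩ e'.source, ∃ U ∈ 𝓝 x,
    ∀ y ∈ U, ∀ z ∈ U, e y (Fin.last n) = e z (Fin.last n) → e' y (Fin.last n) = e' z (Fin.last n)

namespace Foliation

variable {n : ℕ} {M : Type*} [TopologicalSpace M] [ChartedSpace (Model (n + 1)) M]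
  (F : Foliation n M)

/-- The plaque through `x` in the foliation chart `e`: the connected component of `x` in the level
set of the transverse coordinate. -/
def plaque (e : OpenPartialHomeomorph M (Model (n + 1))) (x : M) : Set M :=
  connectedComponentIn {z | z ∈ e.source ∧ e z (Fin.last n) = e x (Fin.last n)} x

/-- The leaf through `x`: the points that can be reached from `x` by a finite chain of plaques. -/
def leaf (x : M) : Set M :=
  {y | Relation.EqvGen (fun a b => ∃ e ∈ F.atlas, a ∈ e.source ∧ b ∈ plaque e a) x y}

/-- The set of leaves. -/
def leaves : Set (Set M) := Set.range F.leaf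

/-- The tangent space at `x` of the leaf through `x`: the vectors along which the transverse
coordinate of the foliation charts at `x` has derivative zero. -/
def leafTangent (x : M) : Submodule ℝ (TangentSpace (𝓡 (n + 1)) x) :=
  ⨅ e ∈ {e | e ∈ F.atlas ∧ x ∈ e.source},
    LinearMap.ker (mfderiv (𝓡 (n + 1)) 𝓘(ℝ, ℝ) (fun z : M => e z (Fin.last n)) x :
      TangentSpace (𝓡 (n + 1)) x →L[ℝ] ℝ).toLinearMap

variable [IsManifold (𝓡 (n + 1)) ∞ M]
  [RiemannianBundle (fun x : M => TangentSpace (𝓡 (n + 1)) x)]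

/-- A transverse orientation of the foliation: a continuous unit vector field normal to the leaves.
(As the foliation is of class `C²`, such a field is automatically of class `C¹`.) -/
structure TransverseOrientation where
  /-- the unit normal field -/
  normal : Π x : M, TangentSpace (𝓡 (n + 1)) x
  continuous_normal :
    Continuous (fun x : M => (⟨x, normal x⟩ : TangentBundle (𝓡 (n + 1)) M))
  norm_normal : ∀ x, ‖normal x‖ = 1
  inner_normal : ∀ x, ∀ v ∈ F.leafTangent x, inner ℝ (normal x) v = 0

variable {F}

/-- The shape operator `v ↦ -(∇_v η)^⊤` at `x` of the leaf through `x`, with respect to the unit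
normal `η`; here `⊤` is the orthogonal projection onto the tangent space of the leaf. -/
def shapeOperator (η : F.TransverseOrientation) (x : M) :
    F.leafTangent x →ₗ[ℝ] F.leafTangent x :=
  haveI : FiniteDimensional ℝ (TangentSpace (𝓡 (n + 1)) x) :=
    inferInstanceAs (FiniteDimensional ℝ (Model (n + 1)));
  ((-((F.leafTangent x).orthogonalProjectionOnto ∘L leviCivita η.normal x ∘L
      (F.leafTangent x).subtypeL) : F.leafTangent x →L[ℝ] F.leafTangent x)).toLinearMap

/-- The mean curvature `H_F(x)`, with respect to the unit normal `η`, of the leaf through `x`: the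
trace of the shape operator, so that the mean curvature vector is `H_F η`. -/
def meanCurvature (η : F.TransverseOrientation) (x : M) : ℝ :=
  LinearMap.trace ℝ (F.leafTangent x) (shapeOperator η x)

/-- A leaf `L` is minimal if its mean curvature vanishes identically. -/
def IsMinimalLeaf (η : F.TransverseOrientation) (L : Set M) : Prop :=
  ∀ x ∈ L, meanCurvature η x = 0

end Foliation

end FoliatedRiemannian

end

/-!
A unit normal field `η` of the foliation satisfies `⟨∇_v η, η⟩ = 0`, so the trace of `∇η` on the
whole tangent space is its trace on the leaves: `div η = -H`. For a test function `φ`, the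
divergence theorem for `φ² η` and the Cauchy-Schwarz inequality give
`|H| ∫ φ² = |∫ 2 φ dφ(η)| ≤ 2 ‖φ‖ ‖∇φ‖`, hence `(H² / 4) ∫ φ² ≤ ∫ |∇φ|²`
(`sq_mul_lintegral_le_lintegral_grad`). This passes to `H₀¹(M)` (`le_fundamentalTone`), so that
`H² / 4 ≤ λ*(M) = 0`.

Three ingredients need work.

* Regularity: `η` is only assumed continuous, but in terms of a transverse coordinate `t` it is
  `± ∇t / |∇t|` with a locally constant sign, hence `C¹` (`contDiffOn_fieldInChart`).
* The Riemannian measure, a supremum of measures carried by the charts, restricts to `√(det g) dy`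
  on each chart (`restrict_riemannianVolume`), by the change of variables formula.
* The divergence theorem (`integral_derivAlong_eq`). The covariant derivative at a point is computed
  in the chart centred at that point, so the identity `tr ∇X = (1 / √g) ∂ₖ(√g Xᵏ)` is only
  available at the centre of a chart (`divergence_density_smul`). The invariance of the right-hand
  side under coordinate changes is not needed: by continuity it is within `ε` of `-H` near the
  centre, and a partition of unity subordinate to such neighbourhoods gives
  `|∫ dψ(X) - H ∫ ψ| ≤ ε ∫ ψ` for all `ψ ≥ 0` and all `ε > 0`.
-/

noncomputable section

namespace FoliatedRiemannian

/-! ### Determinants and inverses of matrix-valued functions -/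

section MatrixCalculus

variable {E : Type*} [NormedAddCommGroup E] [NormedSpace ℝ E] {d : ℕ}

lemma contDiffAt_det {m : WithTop ℕ∞} {A : E → Matrix (Fin d) (Fin d) ℝ} {y : E}
    (hA : ∀ i j, ContDiffAt ℝ m (fun z => A z i j) y) :
    ContDiffAt ℝ m (fun z => (A z).det) y := by
  simp only [Matrix.det_apply']
  exact ContDiffAt.sum fun σ _ => contDiffAt_const.mul (contDiffAt_prod fun i _ => hA _ _)

lemma contDiffAt_inv_apply {m : WithTop ℕ∞} {A : E → Matrix (Fin d) (Fin d) ℝ} {y : E}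
    (hA : ∀ i j, ContDiffAt ℝ m (fun z => A z i j) y) (hdet : (A y).det ≠ 0) (i j : Fin d) :
    ContDiffAt ℝ m (fun z => (A z)⁻¹ i j) y := by
  simp only [Matrix.inv_def, Matrix.smul_apply, Ring.inverse_eq_inv', smul_eq_mul,
    Matrix.adjugate_apply]
  refine ((contDiffAt_det hA).inv hdet).mul (contDiffAt_det fun k l => ?_)
  simp only [Matrix.updateRow_apply]
  split_ifs
  · exact contDiffAt_const
  · exact hA k l

/-- Jacobi's formula for the derivative of a determinant, `d(det A) = det A · tr(A⁻¹ dA)`. -/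
lemma fderiv_det {A : E → Matrix (Fin d) (Fin d) ℝ} {y : E}
    (hA : ∀ i j, DifferentiableAt ℝ (fun z => A z i j) y) (hdet : (A y).det ≠ 0) (v : E) :
    fderiv ℝ (fun z => (A z).det) y v =
      (A y).det * ∑ k, ∑ l, (A y)⁻¹ k l * fderiv ℝ (fun z => A z l k) y v := by
  have hprod : ∀ σ : Equiv.Perm (Fin d), HasFDerivAt (fun z => ∏ i, A z (σ i) i)
      (∑ i, (∏ j ∈ Finset.univ.erase i, A y (σ j) j) •
        fderiv ℝ (fun z => A z (σ i) i) y) y := fun σ =>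
    HasFDerivAt.finsetProd fun i _ => (hA (σ i) i).hasFDerivAt
  have hcol : ∀ i, (∑ σ : Equiv.Perm (Fin d), ((Equiv.Perm.sign σ : ℤ) : ℝ) *
      ((∏ j ∈ Finset.univ.erase i, A y (σ j) j) * fderiv ℝ (fun z => A z (σ i) i) y v)) =
      ((A y).updateCol i fun l => fderiv ℝ (fun z => A z l i) y v).det := by
    intro i
    rw [Matrix.det_apply']
    refine Finset.sum_congr rfl fun σ _ => ?_
    rw [← Finset.mul_prod_erase Finset.univ _ (Finset.mem_univ i), Matrix.updateCol_self,
      mul_comm (∏ j ∈ Finset.univ.erase i, A y (σ j) j)]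
    congr 2
    refine Finset.prod_congr rfl fun j hj => ?_
    rw [Matrix.updateCol_ne (Finset.ne_of_mem_erase hj)]
  have hder : HasFDerivAt (fun z => (A z).det) (∑ σ : Equiv.Perm (Fin d),
      ((Equiv.Perm.sign σ : ℤ) : ℝ) • ∑ i, (∏ j ∈ Finset.univ.erase i, A y (σ j) j) •
        fderiv ℝ (fun z => A z (σ i) i) y) y := by
    simp only [Matrix.det_apply']
    exact HasFDerivAt.fun_sum fun σ _ => (hprod σ).const_mul _
  rw [hder.fderiv]
  simp only [_root_.sum_apply, _root_.smul_apply, smul_eq_mul,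
    Finset.mul_sum]
  rw [Finset.sum_comm]
  refine Finset.sum_congr rfl fun i _ => ?_
  rw [hcol i, ← Matrix.cramer_apply, Matrix.cramer_eq_adjugate_mulVec]
  simp only [Matrix.mulVec, dotProduct]
  refine Finset.sum_congr rfl fun l _ => ?_
  rw [Matrix.inv_def, Matrix.smul_apply, Ring.inverse_eq_inv', smul_eq_mul]
  field_simp

end MatrixCalculus

/-! ### Integration by parts in Euclidean space -/

section IntegrationByParts

variable {d : ℕ}

/-- The Euclidean divergence `∑ₖ ∂ₖYᵏ` of a vector field `Y` on `ℝᵈ`. -/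
def divergence (Y : Model d → Model d) (y : Model d) : ℝ :=
  ∑ k, fderiv ℝ Y y (EuclideanSpace.single k 1) k

lemma continuous_apply_coord (k : Fin d) : Continuous fun v : Model d => v k := by fun_prop

lemma fderiv_coord {Y : Model d → Model d} {y : Model d} (hY : DifferentiableAt ℝ Y y)
    (k : Fin d) (v : Model d) : fderiv ℝ (fun z => Y z k) y v = fderiv ℝ Y y v k := by
  have h := (EuclideanSpace.proj k : Model d →L[ℝ] ℝ).hasFDerivAt.comp y
    hY.hasFDerivAt
  have h' : HasFDerivAt (fun z => Y z k)
    ((EuclideanSpace.proj k : Model d →L[ℝ] ℝ).comp (fderiv ℝ Y y)) y := h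
  rw [h'.fderiv]
  rfl

lemma integral_fderiv_coord_eq_zero {f : Model d → ℝ} (hf : ContDiff ℝ 1 f)
    (hc : HasCompactSupport f) (v : Model d) : ∫ y, fderiv ℝ f y v = 0 := by
  have hcont : Continuous fun y => fderiv ℝ f y v :=
    (hf.continuous_fderiv one_ne_zero).clm_apply continuous_const
  have hcs : HasCompactSupport fun y => fderiv ℝ f y v := hc.fderiv_apply (𝕜 := ℝ) v
  have h := integral_mul_fderiv_eq_neg_fderiv_mul_of_integrable (μ := (volume : Measure (Model d)))
    (f := fun _ => (1 : ℝ)) (g := f) (v := v) (by simp)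
    (by simpa using hcont.integrable_of_hasCompactSupport hcs)
    (by simpa using hf.continuous.integrable_of_hasCompactSupport hc)
    (by simp) (fun y _ => hf.differentiable one_ne_zero y)
  simpa using h

lemma integral_divergence_eq_zero {Z : Model d → Model d} (hZ : ContDiff ℝ 1 Z)
    (hc : HasCompactSupport Z) : ∫ y, divergence Z y = 0 := by
  have hcomp : ∀ k : Fin d, ContDiff ℝ 1 fun y => Z y k := fun k =>
    (EuclideanSpace.proj k : Model d →L[ℝ] ℝ).contDiff.comp hZ
  have hcs : ∀ k : Fin d, HasCompactSupport fun y => Z y k := fun k =>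
    hc.comp_left (g := fun v : Model d => v k) rfl
  have heq : ∀ y, divergence Z y =
      ∑ k, fderiv ℝ (fun z => Z z k) y (EuclideanSpace.single k 1) := fun y =>
    Finset.sum_congr rfl fun k _ => (fderiv_coord (hZ.differentiable one_ne_zero y) k _).symm
  simp only [heq]
  rw [integral_finsetSum]
  · exact Finset.sum_eq_zero fun k _ => integral_fderiv_coord_eq_zero (hcomp k) (hcs k) _
  · intro k _
    exact (((hcomp k).continuous_fderiv one_ne_zero).clm_apply
      continuous_const).integrable_of_hasCompactSupport ((hcs k).fderiv_apply (𝕜 := ℝ) _)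

lemma sum_apply_mul_single (L : Model d →L[ℝ] ℝ) (v : Model d) :
    ∑ k, L (EuclideanSpace.single k 1) * v k = L v := by
  conv_rhs => rw [← (EuclideanSpace.basisFun (Fin d) ℝ).sum_repr v]
  simp [mul_comm]

lemma divergence_smul {u : Model d → ℝ} {Y : Model d → Model d} {y : Model d}
    (hu : DifferentiableAt ℝ u y) (hY : DifferentiableAt ℝ Y y) :
    divergence (fun z => u z • Y z) y = fderiv ℝ u y (Y y) + u y * divergence Y y := by
  unfold divergence
  rw [fderiv_fun_smul hu hY, ← sum_apply_mul_single, Finset.mul_sum, ← Finset.sum_add_distrib]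
  refine Finset.sum_congr rfl fun k _ => ?_
  simp [add_comm]

lemma continuousOn_divergence {Y : Model d → Model d} {U : Set (Model d)} (hU : IsOpen U)
    (hY : ContDiffOn ℝ 1 Y U) : ContinuousOn (divergence Y) U := by
  refine continuousOn_finsetSum _ fun k _ => ?_
  exact (continuous_apply_coord k).comp_continuousOn
    ((hY.continuousOn_fderiv_of_isOpen hU le_rfl).clm_apply continuousOn_const)

lemma integrable_mul_of_tsupport_subset {U : Set (Model d)} (hU : IsOpen U)
    {u h : Model d → ℝ} (hu : Continuous u) (hc : HasCompactSupport u) (hsub : tsupport u ⊆ U)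
    (hh : ContinuousOn h U) : Integrable fun y => u y * h y := by
  refine Continuous.integrable_of_hasCompactSupport ?_ hc.mul_right
  rw [continuous_iff_continuousAt]
  intro y
  by_cases hy : y ∈ tsupport u
  · exact hu.continuousAt.mul (hh.continuousAt (hU.mem_nhds (hsub hy)))
  · refine (continuousAt_const (y := (0 : ℝ))).congr ?_
    filter_upwards [(isClosed_tsupport u).isOpen_compl.mem_nhds hy] with z hz
    rw [image_eq_zero_of_notMem_tsupport hz, zero_mul]

/-- Integration by parts for a vector field that is only defined on an open set `U`, against a
function supported in `U`. -/
lemma integral_fderiv_apply_eq_neg_integral_mul_divergence {U : Set (Model d)} (hU : IsOpen U)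
    {u : Model d → ℝ} {Y : Model d → Model d} (hu : ContDiff ℝ 1 u) (hc : HasCompactSupport u)
    (hsub : tsupport u ⊆ U) (hY : ContDiffOn ℝ 1 Y U) :
    ∫ y, fderiv ℝ u y (Y y) = -∫ y, u y * divergence Y y := by
  have hout : ∀ y ∉ tsupport u, (fun z => u z • Y z) =ᶠ[𝓝 y] fun _ => 0 := fun y hy => by
    filter_upwards [(isClosed_tsupport u).isOpen_compl.mem_nhds hy] with z hz
    rw [image_eq_zero_of_notMem_tsupport hz, zero_smul]
  have hZ : ContDiff ℝ 1 fun z => u z • Y z := by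
    rw [contDiff_iff_contDiffAt]
    intro y
    by_cases hy : y ∈ tsupport u
    · exact hu.contDiffAt.smul (hY.contDiffAt (hU.mem_nhds (hsub hy)))
    · exact contDiffAt_const.congr_of_eventuallyEq (hout y hy)
  have hcZ : HasCompactSupport fun z => u z • Y z := hc.smul_right
  have hdiv : ∀ y, divergence (fun z => u z • Y z) y =
      fderiv ℝ u y (Y y) + u y * divergence Y y := by
    intro y
    by_cases hy : y ∈ tsupport u
    · exact divergence_smul (hu.differentiable one_ne_zero y)
        ((hY.contDiffAt (hU.mem_nhds (hsub hy))).differentiableAt one_ne_zero)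
    · have h0 : fderiv ℝ u y = 0 := by
        by_contra h
        exact hy (support_fderiv_subset ℝ h)
      rw [divergence, (hout y hy).fderiv_eq, h0, image_eq_zero_of_notMem_tsupport hy]
      simp
  have hint1 : Integrable fun y => u y * divergence Y y :=
    integrable_mul_of_tsupport_subset hU hu.continuous hc hsub (continuousOn_divergence hU hY)
  have hint2 : Integrable fun y => divergence (fun z => u z • Y z) y := by
    have hcont := continuousOn_divergence isOpen_univ hZ.contDiffOn
    rw [continuousOn_univ] at hcont
    refine hcont.integrable_of_hasCompactSupport (hc.mono' fun y hy => ?_)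
    by_contra h
    apply hy
    rw [hdiv, image_eq_zero_of_notMem_tsupport h]
    have h0 : fderiv ℝ u y = 0 := by
      by_contra h'
      exact h (support_fderiv_subset ℝ h')
    simp [h0]
  have h := integral_divergence_eq_zero hZ hcZ
  have hint3 : Integrable fun y => fderiv ℝ u y (Y y) := by
    refine (hint2.sub hint1).congr (Eventually.of_forall fun y => ?_)
    simp [hdiv]
  simp only [hdiv] at h
  rw [integral_add hint3 hint1] at h
  linarith

end IntegrationByParts

/-! ### The metric and its connection in a chart -/

section Frames

variable {d : ℕ} {M : Type*} [TopologicalSpace M] [ChartedSpace (Model d) M]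
  [IsManifold (𝓡 d) ∞ M]

lemma coords_frame {p q : M} (hq : q ∈ (chartAt (Model d) p).source) (v : Model d) :
    coords p q (frame p q v) = v :=
  (trivializationAt (Model d) (TangentSpace (𝓡 d)) p).continuousLinearMapAt_symmL (R := ℝ)
    (by simpa using hq) v

lemma frame_coords {p q : M} (hq : q ∈ (chartAt (Model d) p).source)
    (v : TangentSpace (𝓡 d) q) : frame p q (coords p q v) = v :=
  (trivializationAt (Model d) (TangentSpace (𝓡 d)) p).symmL_continuousLinearMapAt (R := ℝ)
    (by simpa using hq) v

lemma mfderiv_frame {f : M → ℝ} {p q : M} (hq : q ∈ (chartAt (Model d) p).source)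
    (hf : MDifferentiableAt (𝓡 d) 𝓘(ℝ, ℝ) f q) (v : Model d) :
    mfderiv (𝓡 d) 𝓘(ℝ, ℝ) f q (frame p q v) =
      fderiv ℝ (fun y => f ((chartAt (Model d) p).symm y)) (chartAt (Model d) p q) v := by
  have hsymm : MDifferentiableAt (𝓡 d) (𝓡 d) (chartAt (Model d) p).symm
      (chartAt (Model d) p q) :=
    mdifferentiableAt_atlas_symm (chart_mem_atlas _ _) ((chartAt (Model d) p).map_source hq)
  have hfr : frame p q v =
      mfderiv (𝓡 d) (𝓡 d) (chartAt (Model d) p).symm (chartAt (Model d) p q) v := by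
    have h := TangentBundle.symmL_trivializationAt (I := 𝓡 d) (x₀ := p) (x := q) hq
    simp only [modelWithCornersSelf_coe, Set.range_id, mfderivWithin_univ] at h
    exact DFunLike.congr_fun h v
  have hq' := (chartAt (Model d) p).left_inv hq
  have hf' : HasMFDerivAt (𝓡 d) 𝓘(ℝ, ℝ) f ((chartAt (Model d) p).symm (chartAt (Model d) p q))
      (mfderiv (𝓡 d) 𝓘(ℝ, ℝ) f q) := by
    rw [hq']
    exact hf.hasMFDerivAt
  have hcomp := (hf'.comp (chartAt (Model d) p q) hsymm.hasMFDerivAt).mfderiv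
  rw [mfderiv_eq_fderiv] at hcomp
  rw [hfr]
  exact (DFunLike.congr_fun hcomp v).symm

lemma frame_eq_frame_fderiv {p p' q : M} (hq : q ∈ (chartAt (Model d) p).source)
    (hq' : q ∈ (chartAt (Model d) p').source) (v : Model d) :
    frame p' q v = frame p q (fderiv ℝ (fun y => chartAt (Model d) p ((chartAt (Model d) p').symm y))
      (chartAt (Model d) p' q) v) := by
  rw [← frame_coords hq (frame p' q v)]
  congr 1
  have h1 := TangentBundle.continuousLinearMapAt_trivializationAt_eq_core (I := 𝓡 d) hq
  have h2 := TangentBundle.symmL_trivializationAt_eq_core (I := 𝓡 d) hq'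
  have h3 := tangentCoordChange_comp (I := 𝓡 d) (w := p') (x := q) (y := p) (z := q) (v := v)
    (by simp [hq, hq'])
  have h4 : tangentCoordChange (𝓡 d) p' p q = fderiv ℝ
      (fun y => chartAt (Model d) p ((chartAt (Model d) p').symm y)) (chartAt (Model d) p' q) := by
    rw [tangentCoordChange_def]
    simp only [modelWithCornersSelf_coe, Set.range_id, fderivWithin_univ]
    rfl
  rw [← h4, ← h3]
  unfold coords frame
  rw [h1, h2]
  rfl

lemma frame_eq_sum (p q : M) (v : Model d) :
    frame p q v = ∑ i, v i • frame p q (EuclideanSpace.single i 1) := by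
  conv_lhs => rw [← (EuclideanSpace.basisFun (Fin d) ℝ).sum_repr v]
  simp

end Frames

section Metric

variable {d : ℕ} {M : Type*} [TopologicalSpace M] [ChartedSpace (Model d) M]
  [IsManifold (𝓡 d) ∞ M] [RiemannianBundle (fun x : M => TangentSpace (𝓡 d) x)]

lemma inner_frame (p : M) (y v w : Model d) :
    inner ℝ (frame p ((chartAt (Model d) p).symm y) v) (frame p ((chartAt (Model d) p).symm y) w) =
      ∑ i, ∑ j, metricMatrix p y i j * v i * w j := by
  rw [frame_eq_sum p _ v, frame_eq_sum p _ w, sum_inner]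
  refine Finset.sum_congr rfl fun i _ => ?_
  rw [inner_sum]
  refine Finset.sum_congr rfl fun j _ => ?_
  rw [real_inner_smul_left, real_inner_smul_right, metricMatrix, Matrix.of_apply]
  ring

lemma inner_frame_of_mem {p q : M} (hq : q ∈ (chartAt (Model d) p).source) (v w : Model d) :
    inner ℝ (frame p q v) (frame p q w) =
      ∑ i, ∑ j, metricMatrix p (chartAt (Model d) p q) i j * v i * w j := by
  have h := inner_frame p (chartAt (Model d) p q) v w
  rwa [(chartAt (Model d) p).left_inv hq] at h

lemma metricMatrix_symm (p : M) (y : Model d) (i j : Fin d) :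
    metricMatrix p y i j = metricMatrix p y j i := by
  simp only [metricMatrix, Matrix.of_apply]
  exact real_inner_comm _ _

lemma metricMatrix_posDef {p : M} {y : Model d} (hy : y ∈ (chartAt (Model d) p).target) :
    (metricMatrix p y).PosDef := by
  refine Matrix.PosDef.of_dotProduct_mulVec_pos ?_ fun x hx => ?_
  · ext i j
    simpa using metricMatrix_symm p y j i
  · have h := inner_frame p y (WithLp.toLp 2 x) (WithLp.toLp 2 x)
    have hne : frame p ((chartAt (Model d) p).symm y) (WithLp.toLp 2 x) ≠ 0 := by
      intro h0
      have h1 := coords_frame ((chartAt (Model d) p).map_target hy) (WithLp.toLp 2 x)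
      rw [h0, map_zero] at h1
      exact hx (by simpa using h1.symm)
    have hpos := real_inner_self_pos.mpr hne
    rw [h] at hpos
    refine hpos.trans_eq ?_
    simp only [dotProduct, Matrix.mulVec, Finset.mul_sum]
    refine Finset.sum_congr rfl fun i _ => Finset.sum_congr rfl fun j _ => ?_
    simp
    ring

lemma contDiffOn_metricMatrix
    [IsContMDiffRiemannianBundle (𝓡 d) ∞ (Model d) (fun x : M => TangentSpace (𝓡 d) x)]
    (p : M) (i j : Fin d) :
    ContDiffOn ℝ ∞ (fun y => metricMatrix p y i j) (chartAt (Model d) p).target := by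
  set e := trivializationAt (Model d) (TangentSpace (𝓡 d)) p with he
  have hframe : ∀ i : Fin d, ContMDiffOn (𝓡 d) (𝓡 d).tangent ∞
      (fun q => (⟨q, frame p q (EuclideanSpace.single i 1)⟩ : TangentBundle (𝓡 d) M))
      (chartAt (Model d) p).source := by
    intro i
    have h := e.contMDiffOn_localFrame_baseSet (I := 𝓡 d) ∞
      (EuclideanSpace.basisFun (Fin d) ℝ).toBasis i
    have hbase : e.baseSet = (chartAt (Model d) p).source := by simp [he]
    rw [hbase] at h
    refine h.congr fun q hq => ?_
    have hq' : q ∈ e.baseSet := by simpa [he] using hq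
    congr 1
    rw [e.localFrame_apply_of_mem_baseSet _ hq']
    simp only [Bundle.Trivialization.basisAt, Module.Basis.map_apply,
      OrthonormalBasis.coe_toBasis, EuclideanSpace.basisFun_apply]
    exact e.symmL_apply hq' _
  have hinner := (hframe i).inner_bundle (hframe j)
  have hsymm := contMDiffOn_chart_symm (I := 𝓡 d) (n := ∞) (x := p)
  have hcomp := hinner.comp hsymm (chartAt (Model d) p).mapsTo_symm
  exact hcomp.contDiffOn

end Metric

section CovariantDerivative

variable {d : ℕ} {M : Type*} [TopologicalSpace M] [ChartedSpace (Model d) M]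
  [IsManifold (𝓡 d) ∞ M] [RiemannianBundle (fun x : M => TangentSpace (𝓡 d) x)]

lemma trace_leviCivita (X : Π q : M, TangentSpace (𝓡 d) q) (p : M) :
    LinearMap.trace ℝ (TangentSpace (𝓡 d) p) (leviCivita X p).toLinearMap =
      ∑ k, covariantInChart X p (chartAt (Model d) p p) (EuclideanSpace.single k 1) k := by
  have h1 : (leviCivita X p).toLinearMap = (frame p p).toLinearMap ∘ₗ
    ((covariantInChart X p (chartAt (Model d) p p)).toLinearMap ∘ₗ (coords p p).toLinearMap) := rfl
  have h2 : (coords p p).toLinearMap ∘ₗ (frame p p).toLinearMap =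
      (LinearMap.id : Model d →ₗ[ℝ] Model d) :=
    LinearMap.ext fun v => coords_frame (mem_chart_source (Model d) p) v
  have : FiniteDimensional ℝ (TangentSpace (𝓡 d) p) :=
    inferInstanceAs (FiniteDimensional ℝ (Model d))
  have : Module.Free ℝ (TangentSpace (𝓡 d) p) := Module.Free.of_divisionRing _ _
  rw [h1, LinearMap.trace_comp_comm', LinearMap.comp_assoc, h2, LinearMap.comp_id,
    LinearMap.trace_eq_matrix_trace ℝ (EuclideanSpace.basisFun (Fin d) ℝ).toBasis, Matrix.trace]
  refine Finset.sum_congr rfl fun k _ => ?_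
  simp [LinearMap.toMatrix_apply]

lemma covariantInChart_apply (X : Π q : M, TangentSpace (𝓡 d) q) (p : M) (y v : Model d)
    (k : Fin d) : covariantInChart X p y v k = fderiv ℝ (fieldInChart X p) y v k +
      ∑ i, ∑ j, christoffel p y k i j * v i * fieldInChart X p y j := by
  rw [covariantInChart, _root_.add_apply, PiLp.add_apply]
  congr 1
  simp only [_root_.sum_apply, _root_.smul_apply, ContinuousLinearMap.smulRight_apply,
    PiLp.proj_apply, WithLp.ofLp_sum, Finset.sum_apply, PiLp.smul_apply, smul_eq_mul,
    PiLp.single_apply]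
  rw [Finset.sum_eq_single k]
  · refine Finset.sum_congr rfl fun i _ => Finset.sum_congr rfl fun j _ => ?_
    simp
    ring
  · intro b _ hb
    refine Finset.sum_eq_zero fun i _ => Finset.sum_eq_zero fun j _ => ?_
    simp [hb.symm]
  · simp

lemma metricMatrix_inv_symm (p : M) (y : Model d) (i j : Fin d) :
    (metricMatrix p y)⁻¹ i j = (metricMatrix p y)⁻¹ j i := by
  have h : (metricMatrix p y).transpose = metricMatrix p y := by
    ext i j
    exact metricMatrix_symm p y j i
  rw [← Matrix.transpose_apply (metricMatrix p y)⁻¹, Matrix.transpose_nonsing_inv, h]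

lemma metricPartial_symm (p : M) (y : Model d) (k i j : Fin d) :
    metricPartial p y k i j = metricPartial p y k j i := by
  simp only [metricPartial, metricMatrix_symm p _ i j]

/-- The contracted Christoffel symbols `∑ₖ Γᵏₖⱼ = ½ gᵏˡ ∂ⱼ gₗₖ`. -/
lemma sum_christoffel (p : M) (y : Model d) (j : Fin d) :
    ∑ k, christoffel p y k k j =
      1 / 2 * ∑ k, ∑ l, (metricMatrix p y)⁻¹ k l * metricPartial p y j l k := by
  simp only [christoffel, ← Finset.mul_sum]
  congr 1
  -- the bracketed terms are antisymmetric in `k`, `l` and cancel in the sum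
  have hsplit : ∀ k l, (metricMatrix p y)⁻¹ k l *
      (metricPartial p y k j l + metricPartial p y j k l - metricPartial p y l k j) =
      (metricMatrix p y)⁻¹ k l * metricPartial p y j l k +
      ((metricMatrix p y)⁻¹ k l * metricPartial p y k j l -
        (metricMatrix p y)⁻¹ l k * metricPartial p y l j k) := fun k l => by
    rw [metricMatrix_inv_symm p y l k, metricPartial_symm p y j l k, metricPartial_symm p y l k j]
    ring
  simp only [hsplit, Finset.sum_add_distrib, Finset.sum_sub_distrib]
  rw [Finset.sum_comm (f := fun k l => (metricMatrix p y)⁻¹ l k * metricPartial p y l j k)]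
  ring

/-- The Christoffel symbols of the first kind,
`∑ₖ gₖₘ Γᵏᵢⱼ = ½ (∂ᵢ gⱼₘ + ∂ⱼ gᵢₘ - ∂ₘ gᵢⱼ)`. -/
lemma sum_metricMatrix_mul_christoffel {p : M} {y : Model d}
    (hy : y ∈ (chartAt (Model d) p).target) (m i j : Fin d) :
    ∑ k, metricMatrix p y k m * christoffel p y k i j =
      1 / 2 * (metricPartial p y i j m + metricPartial p y j i m - metricPartial p y m i j) := by
  have hinv : metricMatrix p y * (metricMatrix p y)⁻¹ = 1 :=
    Matrix.mul_nonsing_inv _ (metricMatrix_posDef hy).det_pos.ne'.isUnit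
  have hml : ∀ l, ∑ k, metricMatrix p y k m * (metricMatrix p y)⁻¹ k l = if m = l then 1 else 0 :=
    fun l => by
      rw [← Matrix.one_apply, ← hinv, Matrix.mul_apply]
      simp only [metricMatrix_symm p y _ m]
  simp only [christoffel, Finset.mul_sum]
  rw [Finset.sum_comm]
  have hterm : ∀ l, ∑ k, metricMatrix p y k m * (1 / 2 * ((metricMatrix p y)⁻¹ k l *
      (metricPartial p y i j l + metricPartial p y j i l - metricPartial p y l i j))) =
      (if m = l then 1 else 0) * (1 / 2 *
        (metricPartial p y i j l + metricPartial p y j i l - metricPartial p y l i j)) := fun l => by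
    rw [← hml l, Finset.sum_mul]
    exact Finset.sum_congr rfl fun k _ => by ring
  simp only [hterm]
  simp

/-- The density `√(det g)` of the Riemannian measure in the chart centred at `p`. -/
def density (p : M) (y : Model d) : ℝ := Real.sqrt (metricMatrix p y).det

lemma density_pos {p : M} {y : Model d} (hy : y ∈ (chartAt (Model d) p).target) :
    0 < density p y := Real.sqrt_pos.mpr (metricMatrix_posDef hy).det_pos

variable [IsContMDiffRiemannianBundle (𝓡 d) ∞ (Model d) (fun x : M => TangentSpace (𝓡 d) x)]

lemma contDiffAt_metricMatrix {p : M} {y : Model d} (hy : y ∈ (chartAt (Model d) p).target)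
    (i j : Fin d) : ContDiffAt ℝ ∞ (fun y => metricMatrix p y i j) y :=
  (contDiffOn_metricMatrix p i j).contDiffAt ((chartAt (Model d) p).open_target.mem_nhds hy)

lemma differentiableAt_metricMatrix {p : M} {y : Model d}
    (hy : y ∈ (chartAt (Model d) p).target) (i j : Fin d) :
    DifferentiableAt ℝ (fun y => metricMatrix p y i j) y :=
  (contDiffAt_metricMatrix hy i j).differentiableAt (by simp)

lemma contDiffOn_density (p : M) :
    ContDiffOn ℝ ∞ (density (d := d) p) (chartAt (Model d) p).target := fun _ hy =>
  ((contDiffAt_det (contDiffAt_metricMatrix hy)).sqrt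
    (metricMatrix_posDef hy).det_pos.ne').contDiffWithinAt

lemma differentiableAt_density {p : M} {y : Model d} (hy : y ∈ (chartAt (Model d) p).target) :
    DifferentiableAt ℝ (density (d := d) p) y :=
  ((contDiffOn_density p).contDiffAt
    ((chartAt (Model d) p).open_target.mem_nhds hy)).differentiableAt (by simp)

lemma fderiv_density {p : M} {y : Model d} (hy : y ∈ (chartAt (Model d) p).target)
    (j : Fin d) : fderiv ℝ (density p) y (EuclideanSpace.single j 1) =
      density p y * ∑ k, christoffel p y k k j := by
  have hpos := (metricMatrix_posDef hy).det_pos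
  have hdet := ((contDiffAt_det (contDiffAt_metricMatrix hy)).differentiableAt
    (by simp)).hasFDerivAt.sqrt hpos.ne'
  have hJ := fderiv_det (differentiableAt_metricMatrix hy) hpos.ne' (EuclideanSpace.single j 1)
  have hd : fderiv ℝ (density p) y = _ := hdet.fderiv
  rw [hd, _root_.smul_apply, hJ, sum_christoffel, density, smul_eq_mul]
  have hs := Real.mul_self_sqrt hpos.le
  have hs' := (Real.sqrt_pos.mpr hpos).ne'
  simp only [metricPartial]
  nth_rw 2 [← hs]
  field_simp

/-- The trace of the covariant derivative is the divergence: at the centre of the chart,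
`tr ∇X = (1 / √g) ∂ₖ(√g Xᵏ)`. -/
lemma divergence_density_smul (X : Π q : M, TangentSpace (𝓡 d) q) (p : M)
    (hX : DifferentiableAt ℝ (fieldInChart X p) (chartAt (Model d) p p)) :
    divergence (fun y => density p y • fieldInChart X p y) (chartAt (Model d) p p) =
      density p (chartAt (Model d) p p) *
        LinearMap.trace ℝ (TangentSpace (𝓡 d) p) (leviCivita X p).toLinearMap := by
  set y := chartAt (Model d) p p with hy_def
  have hy : y ∈ (chartAt (Model d) p).target := mem_chart_target _ p
  rw [divergence_smul (differentiableAt_density hy) hX, trace_leviCivita, ← sum_apply_mul_single,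
    ← hy_def]
  simp only [fderiv_density hy, covariantInChart_apply, Finset.sum_add_distrib]
  rw [divergence, mul_add, add_comm]
  congr 1
  have hδ : ∀ k, ∑ i, ∑ j, christoffel p y k i j * (EuclideanSpace.single k (1 : ℝ) : Model d) i *
      fieldInChart X p y j = ∑ j, christoffel p y k k j * fieldInChart X p y j := fun k => by
    rw [Finset.sum_eq_single k]
    · simp
    · intro i _ hi
      simp [hi]
    · simp
  simp only [hδ]
  rw [Finset.sum_comm, Finset.mul_sum]
  simp only [Finset.sum_mul, mul_assoc]

/-- A field of constant length is orthogonal to its covariant derivatives. -/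
lemma inner_leviCivita_self (X : Π q : M, TangentSpace (𝓡 d) q) (p : M)
    (hX : DifferentiableAt ℝ (fieldInChart X p) (chartAt (Model d) p p))
    (hnorm : ∀ q, ‖X q‖ = 1) (v : TangentSpace (𝓡 d) p) :
    inner ℝ (leviCivita X p v) (X p) = 0 := by
  set y := chartAt (Model d) p p with hy_def
  have hsrc : p ∈ (chartAt (Model d) p).source := mem_chart_source _ p
  have hy : y ∈ (chartAt (Model d) p).target := mem_chart_target _ p
  have hyp : (chartAt (Model d) p).symm y = p := (chartAt (Model d) p).left_inv hsrc
  set u : Model d := coords p p v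
  set Y : Model d → Model d := fieldInChart X p
  have hone : ∀ z ∈ (chartAt (Model d) p).target,
      ∑ i, ∑ j, metricMatrix p z i j * Y z i * Y z j = 1 := by
    intro z hz
    rw [← inner_frame]
    simp only [Y, fieldInChart]
    rw [frame_coords ((chartAt (Model d) p).map_target hz), real_inner_self_eq_norm_sq, hnorm]
    norm_num
  have hYk : ∀ k, HasFDerivAt (fun z => Y z k)
      (fderiv ℝ (fun z => Y z k) y) y := fun k =>
    ((EuclideanSpace.proj k : Model d →L[ℝ] ℝ).differentiableAt.comp y hX).hasFDerivAt
  have hder : HasFDerivAt (fun z => ∑ i, ∑ j, metricMatrix p z i j * Y z i * Y z j) _ y :=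
    HasFDerivAt.fun_sum fun i _ => HasFDerivAt.fun_sum fun j _ =>
      (((differentiableAt_metricMatrix hy i j).hasFDerivAt.mul (hYk i)).mul (hYk j))
  have hzero : HasFDerivAt (fun z => ∑ i, ∑ j, metricMatrix p z i j * Y z i * Y z j)
      (0 : Model d →L[ℝ] ℝ) y := by
    refine (hasFDerivAt_const (1 : ℝ) y).congr_of_eventuallyEq ?_
    filter_upwards [(chartAt (Model d) p).open_target.mem_nhds hy] with z hz using hone z hz
  -- `∂ᵤ (gᵢⱼ Yⁱ Yʲ) = 0`
  have h0 := DFunLike.congr_fun (hder.unique hzero) u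
  simp only [_root_.sum_apply, _root_.add_apply, _root_.smul_apply, smul_eq_mul,
    fderiv_coord hX, _root_.zero_apply] at h0
  have hpart : ∀ i j, fderiv ℝ (fun z => metricMatrix p z i j) y u =
      ∑ a, metricPartial p y a i j * u a := fun i j => (sum_apply_mul_single _ u).symm
  simp only [hpart] at h0
  have hXp : X p = frame p p (Y y) := by
    have h : fieldInChart X p y = coords p p (X p) := by
      unfold fieldInChart
      rw [hyp]
    rw [show Y y = coords p p (X p) from h, frame_coords hsrc]
  have hcov : leviCivita X p v = frame p p (covariantInChart X p y u) := rfl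
  rw [hcov, hXp, inner_frame_of_mem hsrc, ← hy_def]
  simp only [covariantInChart_apply]
  change ∑ k, ∑ m, metricMatrix p y k m * (fderiv ℝ Y y u k +
    ∑ a, ∑ b, christoffel p y k a b * u a * Y y b) * Y y m = 0
  change ∑ k, ∑ m, (metricMatrix p y k m * Y y k * fderiv ℝ Y y u m +
    Y y m * (metricMatrix p y k m * fderiv ℝ Y y u k +
      Y y k * ∑ a, metricPartial p y a k m * u a)) = 0 at h0
  have hflip : ∑ k, ∑ m, metricMatrix p y k m * Y y k * fderiv ℝ Y y u m =
      ∑ k, ∑ m, metricMatrix p y k m * fderiv ℝ Y y u k * Y y m := by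
    rw [Finset.sum_comm]
    refine Finset.sum_congr rfl fun m _ => Finset.sum_congr rfl fun k _ => ?_
    rw [metricMatrix_symm p y k m]
    ring
  have hΓ : ∑ k, ∑ m, metricMatrix p y k m *
      (∑ a, ∑ b, christoffel p y k a b * u a * Y y b) * Y y m =
      1 / 2 * ∑ k, ∑ m, Y y m * (Y y k * ∑ a, metricPartial p y a k m * u a) := by
    have h1 : ∑ k, ∑ m, metricMatrix p y k m *
        (∑ a, ∑ b, christoffel p y k a b * u a * Y y b) * Y y m =
        ∑ a, ∑ b, ∑ m, (∑ k, metricMatrix p y k m * christoffel p y k a b) *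
          (u a * Y y b * Y y m) := by
      simp only [Finset.mul_sum, Finset.sum_mul]
      rw [Finset.sum_comm, Finset.sum_congr rfl fun m _ => Finset.sum_comm, Finset.sum_comm]
      refine Finset.sum_congr rfl fun a _ => ?_
      rw [Finset.sum_congr rfl fun m _ => Finset.sum_comm, Finset.sum_comm]
      refine Finset.sum_congr rfl fun b _ => Finset.sum_congr rfl fun m _ =>
        Finset.sum_congr rfl fun k _ => ?_
      ring
    have h2 : ∑ k, ∑ m, Y y m * (Y y k * ∑ a, metricPartial p y a k m * u a) =
        ∑ a, ∑ b, ∑ m, metricPartial p y a b m * (u a * Y y b * Y y m) := by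
      simp only [Finset.mul_sum]
      rw [Finset.sum_congr rfl fun m _ => Finset.sum_comm, Finset.sum_comm]
      refine Finset.sum_congr rfl fun a _ => Finset.sum_congr rfl fun b _ =>
        Finset.sum_congr rfl fun m _ => ?_
      ring
    rw [h1, h2, Finset.mul_sum]
    refine Finset.sum_congr rfl fun a _ => ?_
    simp only [sum_metricMatrix_mul_christoffel hy]
    -- the last two Christoffel terms are exchanged by `b ↔ m`
    have h3 : ∑ b, ∑ m, metricPartial p y b a m * (u a * Y y b * Y y m) =
        ∑ b, ∑ m, metricPartial p y m a b * (u a * Y y b * Y y m) := by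
      rw [Finset.sum_comm]
      exact Finset.sum_congr rfl fun b _ => Finset.sum_congr rfl fun m _ => by ring
    have h4 : ∀ b m, 1 / 2 * (metricPartial p y a b m + metricPartial p y b a m -
        metricPartial p y m a b) * (u a * Y y b * Y y m) =
        1 / 2 * (metricPartial p y a b m * (u a * Y y b * Y y m)) +
        1 / 2 * (metricPartial p y b a m * (u a * Y y b * Y y m)) -
        1 / 2 * (metricPartial p y m a b * (u a * Y y b * Y y m)) := fun b m => by ring
    simp only [h4, Finset.sum_add_distrib, Finset.sum_sub_distrib, ← Finset.mul_sum]
    rw [h3]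
    ring
  simp only [mul_add, add_mul, Finset.sum_add_distrib] at h0 ⊢
  rw [hflip] at h0
  have hcomm : ∑ k, ∑ m, Y y m * (metricMatrix p y k m * fderiv ℝ Y y u k) =
      ∑ k, ∑ m, metricMatrix p y k m * fderiv ℝ Y y u k * Y y m :=
    Finset.sum_congr rfl fun k _ => Finset.sum_congr rfl fun m _ => by ring
  rw [hcomm] at h0
  rw [hΓ]
  linarith

end CovariantDerivative

/-! ### The Riemannian measure in a chart -/

section Volume

variable {d : ℕ} {M : Type*} [TopologicalSpace M] [ChartedSpace (Model d) M]
  [IsManifold (𝓡 d) ∞ M] [RiemannianBundle (fun x : M => TangentSpace (𝓡 d) x)]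

/-- The coordinate change from the chart centred at `p'` to the chart centred at `p`. -/
def chartChange (p p' : M) (y : Model d) : Model d :=
  chartAt (Model d) p ((chartAt (Model d) p').symm y)

omit [RiemannianBundle (fun x : M => TangentSpace (𝓡 d) x)] in
lemma differentiableAt_chartChange {p p' q : M} (hq : q ∈ (chartAt (Model d) p).source)
    (hq' : q ∈ (chartAt (Model d) p').source) :
    DifferentiableAt ℝ (chartChange p p') (chartAt (Model d) p' q) := by
  have h := hasFDerivWithinAt_tangentCoordChange (I := 𝓡 d) (x := p') (y := p) (z := q)
    (by simp [hq, hq'])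
  simp only [modelWithCornersSelf_coe, Set.range_id, hasFDerivWithinAt_univ] at h
  exact h.differentiableAt

/-- The density of the Riemannian measure transforms by the Jacobian of the coordinate change. -/
lemma density_eq_abs_det_mul {p p' q : M} (hq : q ∈ (chartAt (Model d) p).source)
    (hq' : q ∈ (chartAt (Model d) p').source) :
    density p' (chartAt (Model d) p' q) =
      |(fderiv ℝ (chartChange p p') (chartAt (Model d) p' q)).det| *
        density p (chartAt (Model d) p q) := by
  set D := fderiv ℝ (chartChange p p') (chartAt (Model d) p' q)
  set b := (EuclideanSpace.basisFun (Fin d) ℝ).toBasis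
  set J := LinearMap.toMatrix b b D.toLinearMap with hJ
  have hJij : ∀ k i, J k i = D (EuclideanSpace.single i 1) k := fun k i => by
    simp [hJ, b, LinearMap.toMatrix_apply]
  have hG : metricMatrix p' (chartAt (Model d) p' q) =
      J.transpose * metricMatrix p (chartAt (Model d) p q) * J := by
    ext i j
    rw [metricMatrix, Matrix.of_apply, (chartAt (Model d) p').left_inv hq',
      frame_eq_frame_fderiv hq hq', frame_eq_frame_fderiv hq hq', inner_frame_of_mem hq]
    simp only [Matrix.mul_apply, Matrix.transpose_apply, hJij, Finset.sum_mul]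
    rw [Finset.sum_comm]
    refine Finset.sum_congr rfl fun l _ => Finset.sum_congr rfl fun k _ => ?_
    change metricMatrix p _ k l * D _ k * D _ l = D _ k * metricMatrix p _ k l * D _ l
    ring
  have hdet : D.det = J.det := by
    rw [hJ, LinearMap.det_toMatrix]
  rw [density, hG, Matrix.det_mul, Matrix.det_mul, Matrix.det_transpose, hdet, density,
    ← Real.sqrt_sq_eq_abs, ← Real.sqrt_mul (sq_nonneg _)]
  congr 1
  ring

variable [MeasurableSpace M] [BorelSpace M]

omit [IsManifold (𝓡 d) ∞ M] [RiemannianBundle (fun x : M => TangentSpace (𝓡 d) x)] in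
lemma measurableSet_image_chart (p : M) {A : Set M} (hA : MeasurableSet A)
    (hsub : A ⊆ (chartAt (Model d) p).source) : MeasurableSet (chartAt (Model d) p '' A) := by
  rw [(chartAt (Model d) p).image_eq_target_inter_inv_preimage hsub,
    ← Subtype.image_preimage_coe]
  refine (chartAt (Model d) p).open_target.measurableSet.subtype_image ?_
  exact (continuousOn_iff_continuous_domRestrict.mp
    (chartAt (Model d) p).continuousOn_symm).measurable hA

lemma aemeasurable_chart_symm (p : M) : AEMeasurable (chartAt (Model d) p).symm
    ((volume.restrict (chartAt (Model d) p).target).withDensity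
      fun y => ENNReal.ofReal (Real.sqrt (metricMatrix p y).det)) :=
  ((chartAt (Model d) p).continuousOn_symm.aemeasurable
    (chartAt (Model d) p).open_target.measurableSet).mono_ac (withDensity_absolutelyContinuous _ _)

lemma chartVolume_apply (p : M) {A : Set M} (hA : MeasurableSet A)
    (hsub : A ⊆ (chartAt (Model d) p).source) :
    chartVolume (d := d) p A =
      ∫⁻ y in chartAt (Model d) p '' A, ENNReal.ofReal (density p y) := by
  have hnull : NullMeasurableSet ((chartAt (Model d) p).symm ⁻¹' A)
      (volume.restrict (chartAt (Model d) p).target) :=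
    ((chartAt (Model d) p).continuousOn_symm.aemeasurable
      (chartAt (Model d) p).open_target.measurableSet).nullMeasurable hA
  rw [chartVolume, Measure.map_apply_of_aemeasurable (aemeasurable_chart_symm p) hA,
    withDensity_apply₀ _ hnull, Measure.restrict_restrict₀ hnull, Set.inter_comm,
    ← (chartAt (Model d) p).image_eq_target_inter_inv_preimage hsub]
  rfl

lemma chartVolume_compl_source (p : M) :
    chartVolume (d := d) p (chartAt (Model d) p).sourceᶜ = 0 := by
  rw [chartVolume, Measure.map_apply_of_aemeasurable (aemeasurable_chart_symm p)
    (chartAt (Model d) p).open_source.measurableSet.compl]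
  refine (withDensity_absolutelyContinuous _ _) ?_
  refine measure_mono_null (t := (chartAt (Model d) p).targetᶜ) ?_ ?_
  · intro y hy hy'
    exact hy ((chartAt (Model d) p).map_target hy')
  · rw [Measure.restrict_apply (chartAt (Model d) p).open_target.measurableSet.compl]
    simp

/-- The measures `√(det g) dy` of two charts agree on the overlap of their domains. -/
lemma chartVolume_apply_eq (p p' : M) {A : Set M} (hA : MeasurableSet A)
    (hsub : A ⊆ (chartAt (Model d) p).source) (hsub' : A ⊆ (chartAt (Model d) p').source) :
    chartVolume (d := d) p A = chartVolume (d := d) p' A := by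
  have hmeas := measurableSet_image_chart p' hA hsub'
  have himg : chartAt (Model d) p '' A = chartChange p p' '' (chartAt (Model d) p' '' A) := by
    rw [Set.image_image]
    refine Set.image_congr fun q hq => ?_
    rw [chartChange, (chartAt (Model d) p').left_inv (hsub' hq)]
  rw [chartVolume_apply p hA hsub, chartVolume_apply p' hA hsub', himg,
    lintegral_image_eq_lintegral_abs_det_fderiv_mul volume hmeas
      (f' := fun y => fderiv ℝ (chartChange p p') y)]
  · refine setLIntegral_congr_fun hmeas ?_
    rintro _ ⟨q, hq, rfl⟩
    simp only
    rw [density_eq_abs_det_mul (hsub hq) (hsub' hq), ENNReal.ofReal_mul (abs_nonneg _), chartChange,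
      (chartAt (Model d) p').left_inv (hsub' hq)]
  · rintro _ ⟨q, hq, rfl⟩
    exact (differentiableAt_chartChange (hsub hq) (hsub' hq)).hasFDerivAt.hasFDerivWithinAt
  · rintro _ ⟨q, hq, rfl⟩ _ ⟨r, hr, rfl⟩ h
    simp only [chartChange] at h
    rw [(chartAt (Model d) p').left_inv (hsub' hq), (chartAt (Model d) p').left_inv (hsub' hr)] at h
    rw [(chartAt (Model d) p).injOn (hsub hq) (hsub hr) h]

/-- On the domain of a chart the Riemannian measure is `√(det g) dy`. -/
lemma restrict_riemannianVolume (p : M) :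
    (riemannianVolume d M).restrict (chartAt (Model d) p).source = chartVolume (d := d) p := by
  set S := (chartAt (Model d) p).source with hS_def
  have hS : MeasurableSet S := (chartAt (Model d) p).open_source.measurableSet
  have hself : (chartVolume (d := d) p).restrict S = chartVolume (d := d) p :=
    Measure.restrict_eq_self_of_ae_mem (chartVolume_compl_source p)
  refine le_antisymm ?_ ?_
  -- off the chart the supremum is its own upper bound, which leaves only the overlaps to compare
  · have hle : riemannianVolume d M ≤
        chartVolume (d := d) p + (riemannianVolume d M).restrict Sᶜ := by
      refine iSup_le fun q => ?_
      have hqS : (chartVolume (d := d) q).restrict S ≤ chartVolume (d := d) p := by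
        refine Measure.le_iff.mpr fun A hA => ?_
        rw [Measure.restrict_apply hA]
        have h1 : chartVolume (d := d) q (A ∩ S) =
            chartVolume (d := d) q (A ∩ S ∩ (chartAt (Model d) q).source) := by
          have h0 : chartVolume (d := d) q ((A ∩ S) \ (chartAt (Model d) q).source) = 0 :=
            measure_mono_null (fun x hx => hx.2) (chartVolume_compl_source q)
          rw [← measure_inter_add_sdiff (A ∩ S) (chartAt (Model d) q).open_source.measurableSet,
            h0, add_zero]
        rw [h1, chartVolume_apply_eq q p ((hA.inter hS).inter
          (chartAt (Model d) q).open_source.measurableSet) (fun x hx => hx.2) (fun x hx => hx.1.2)]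
        exact measure_mono fun x hx => hx.1.1
      calc chartVolume (d := d) q = (chartVolume (d := d) q).restrict S +
            (chartVolume (d := d) q).restrict Sᶜ := (Measure.restrict_add_restrict_compl hS).symm
        _ ≤ _ := add_le_add hqS (Measure.restrict_mono_measure (le_iSup _ q) _)
    calc (riemannianVolume d M).restrict S
        ≤ (chartVolume (d := d) p + (riemannianVolume d M).restrict Sᶜ).restrict S :=
          Measure.restrict_mono_measure hle S
      _ = chartVolume (d := d) p := by
          rw [Measure.restrict_add, hself, Measure.restrict_restrict hS, Set.inter_compl_self,
            Measure.restrict_empty, add_zero]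
  · rw [← hself]
    exact Measure.restrict_mono_measure (le_iSup (chartVolume (d := d)) p) S

variable [IsContMDiffRiemannianBundle (𝓡 d) ∞ (Model d) (fun x : M => TangentSpace (𝓡 d) x)]

/-- The integral over `M` of a function supported in a chart, in coordinates. -/
lemma integral_riemannianVolume (p : M) {f : M → ℝ} (hf : Continuous f)
    (hsupp : ∀ x ∉ (chartAt (Model d) p).source, f x = 0) :
    ∫ x, f x ∂(riemannianVolume d M) =
      ∫ y in (chartAt (Model d) p).target, density p y * f ((chartAt (Model d) p).symm y) := by
  rw [← setIntegral_eq_integral_of_forall_compl_eq_zero hsupp, restrict_riemannianVolume,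
    chartVolume]
  have hdens : AEMeasurable (fun y => (density p y).toNNReal)
      (volume.restrict (chartAt (Model d) p).target) :=
    ((contDiffOn_density p).continuousOn.aemeasurable
      (chartAt (Model d) p).open_target.measurableSet).real_toNNReal
  rw [integral_map (aemeasurable_chart_symm p) hf.aestronglyMeasurable]
  refine (integral_withDensity_eq_integral_smul₀ hdens _).trans ?_
  refine integral_congr_ae (Eventually.of_forall fun y => ?_)
  simp only [NNReal.smul_def, smul_eq_mul]
  rw [Real.coe_toNNReal (density p y) (Real.sqrt_nonneg _)]

instance : IsLocallyFiniteMeasure (riemannianVolume d M) := by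
  refine ⟨fun x => ?_⟩
  set φ := chartAt (Model d) x
  obtain ⟨K, hK, hKsub, hKc⟩ := local_compact_nhds
    (φ.open_target.mem_nhds (mem_chart_target (Model d) x))
  have hU : IsOpen (φ.source ∩ φ ⁻¹' interior K) :=
    φ.continuousOn.isOpen_inter_preimage φ.open_source isOpen_interior
  refine ⟨φ.source ∩ φ ⁻¹' interior K, hU.mem_nhds
    ⟨mem_chart_source _ x, mem_interior_iff_mem_nhds.mpr hK⟩, ?_⟩
  have hfin : ∫⁻ y in K, ENNReal.ofReal (density x y) < ⊤ :=
    (((contDiffOn_density x).continuousOn.mono hKsub).integrableOn_compact hKc).lintegral_lt_top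
  calc riemannianVolume d M (φ.source ∩ φ ⁻¹' interior K)
      = (riemannianVolume d M).restrict φ.source (φ.source ∩ φ ⁻¹' interior K) := by
        rw [Measure.restrict_apply hU.measurableSet]
        congr 1
        ext z
        simp only [Set.mem_inter_iff]
        tauto
    _ = ∫⁻ y in φ '' (φ.source ∩ φ ⁻¹' interior K), ENNReal.ofReal (density x y) := by
        rw [restrict_riemannianVolume, chartVolume_apply x hU.measurableSet Set.inter_subset_left]
    _ ≤ ∫⁻ y in K, ENNReal.ofReal (density x y) :=
        lintegral_mono_set (by rintro _ ⟨z, hz, rfl⟩; exact interior_subset hz.2)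
    _ < ⊤ := hfin

end Volume

/-! ### Foliations and their normal fields -/

/-- The trace of the compression of `A` to the hyperplane `η^⊥`. -/
lemma trace_compression {V : Type*} [NormedAddCommGroup V] [InnerProductSpace ℝ V]
    [FiniteDimensional ℝ V] {K : Submodule ℝ V} {η : V} (hη : ‖η‖ = 1)
    (hK : ∀ v, v ∈ K ↔ inner ℝ η v = 0) (A : V →L[ℝ] V) :
    LinearMap.trace ℝ K (K.orthogonalProjectionOnto ∘L A ∘L K.subtypeL).toLinearMap =
      LinearMap.trace ℝ V A.toLinearMap - inner ℝ η (A η) := by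
  have hηη : inner ℝ η η = 1 := by rw [real_inner_self_eq_norm_sq, hη, one_pow]
  have hP : ∀ v, (K.orthogonalProjectionOnto v : V) = v - inner ℝ η v • η := by
    intro v
    refine Submodule.eq_starProjection_of_mem_of_inner_eq_zero ?_ ?_
    · rw [hK, inner_sub_right, real_inner_smul_right, hηη]
      ring
    · intro w hw
      rw [sub_sub_cancel, real_inner_smul_left, (hK w).mp hw, mul_zero]
  have h1 : (K.orthogonalProjectionOnto ∘L A ∘L K.subtypeL).toLinearMap =
      K.orthogonalProjectionOnto.toLinearMap ∘ₗ (A.toLinearMap ∘ₗ K.subtype) := rfl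
  -- the trace is cyclic, and the projection is `v ↦ v - ⟨η, v⟩ η`
  have h2 : (A.toLinearMap ∘ₗ K.subtype) ∘ₗ K.orthogonalProjectionOnto.toLinearMap =
      A.toLinearMap - (innerSL ℝ η).toLinearMap.smulRight (A η) := by
    ext v
    simp [hP]
  rw [h1, LinearMap.trace_comp_comm', h2, map_sub, LinearMap.trace_smulRight]
  rfl

namespace Foliation

variable {n : ℕ} {M : Type*} [TopologicalSpace M] [ChartedSpace (Model (n + 1)) M]
  {F : Foliation n M}

/-- The transverse coordinate of a foliation chart. -/
def transverse (e : OpenPartialHomeomorph M (Model (n + 1))) (z : M) : ℝ := e z (Fin.last n)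

/-- The differential at `x` of the transverse coordinate of a foliation chart. -/
def transverseDifferential (e : OpenPartialHomeomorph M (Model (n + 1))) (x : M) :
    TangentSpace (𝓡 (n + 1)) x →L[ℝ] ℝ :=
  mfderiv (𝓡 (n + 1)) 𝓘(ℝ, ℝ) (transverse e) x

lemma contMDiffOn_transverse {e : OpenPartialHomeomorph M (Model (n + 1))} (he : e ∈ F.atlas) :
    ContMDiffOn (𝓡 (n + 1)) 𝓘(ℝ, ℝ) 2 (transverse e) e.source :=
  (EuclideanSpace.proj (Fin.last n) : Model (n + 1) →L[ℝ] ℝ).contMDiff.comp_contMDiffOn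
    (contMDiffOn_of_mem_maximalAtlas (F.atlas_subset he))

lemma mdifferentiableAt_transverse {e : OpenPartialHomeomorph M (Model (n + 1))} (he : e ∈ F.atlas)
    {x : M} (hx : x ∈ e.source) :
    MDifferentiableAt (𝓡 (n + 1)) 𝓘(ℝ, ℝ) (transverse e) x :=
  ((contMDiffOn_transverse he).contMDiffAt (e.open_source.mem_nhds hx)).mdifferentiableAt
    (by norm_num)

/-- All transverse coordinates at a point have the same kernel: a vector that is tangent to the
plaques of `e` is tangent to the plaques of `e'`. -/
lemma transverseDifferential_eq_zero {e e' : OpenPartialHomeomorph M (Model (n + 1))}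
    (he : e ∈ F.atlas) (he' : e' ∈ F.atlas) {x : M} (hx : x ∈ e.source) (hx' : x ∈ e'.source)
    {w : TangentSpace (𝓡 (n + 1)) x}
    (hw : transverseDifferential e x w = 0) :
    transverseDifferential e' x w = 0 := by
  have hex : MDifferentiableAt (𝓡 (n + 1)) (𝓡 (n + 1)) e x :=
    ((contMDiffOn_of_mem_maximalAtlas (F.atlas_subset he)).contMDiffAt
      (e.open_source.mem_nhds hx)).mdifferentiableAt (by norm_num)
  have hsymm : MDifferentiableAt (𝓡 (n + 1)) (𝓡 (n + 1)) e.symm (e x) :=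
    ((contMDiffOn_symm_of_mem_maximalAtlas (F.atlas_subset he)).contMDiffAt
      (e.open_target.mem_nhds (e.map_source hx))).mdifferentiableAt (by norm_num)
  have hex' := hex.hasMFDerivAt
  set v : Model (n + 1) := mfderiv (𝓡 (n + 1)) (𝓡 (n + 1)) e x w with hv
  set g : Model (n + 1) → ℝ := fun y => transverse e' (e.symm y) with hg
  have hgd : MDifferentiableAt (𝓡 (n + 1)) 𝓘(ℝ, ℝ) g (e x) := by
    have h : MDifferentiableAt (𝓡 (n + 1)) 𝓘(ℝ, ℝ) (transverse e') (e.symm (e x)) := by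
      rw [e.left_inv hx]
      exact mdifferentiableAt_transverse he' hx'
    exact h.comp (e x) hsymm
  have hv0 : v (Fin.last n) = 0 := by
    have h := ((EuclideanSpace.proj (Fin.last n) : Model (n + 1) →L[ℝ] ℝ).hasFDerivAt
      (x := e x)).hasMFDerivAt.comp x hex'
    exact (DFunLike.congr_fun h.mfderiv w).symm.trans hw
  have heq : transverse e' =ᶠ[𝓝 x] g ∘ e := by
    filter_upwards [e.open_source.mem_nhds hx] with z hz
    simp only [hg, Function.comp_apply, e.left_inv hz]
  have hchain : transverseDifferential e' x w = fderiv ℝ g (e x) v := by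
    have h := ((hgd.hasMFDerivAt.comp x hex').congr_of_eventuallyEq heq).mfderiv
    rw [mfderiv_eq_fderiv] at h
    exact DFunLike.congr_fun h w
  obtain ⟨U, hU, hUc⟩ := F.compatible e he e' he' x ⟨hx, hx'⟩
  -- `t'` is constant along the coordinate line of `e` in the direction of `w`, since `t` is
  have hline : HasDerivAt (fun s : ℝ => e x + s • v) v 0 := by
    simpa using ((hasDerivAt_id (0 : ℝ)).smul_const v).const_add (e x)
  have hconst : (fun s : ℝ => g (e x + s • v)) =ᶠ[𝓝 0] fun _ => g (e x) := by
    have htend : Tendsto (fun s : ℝ => e x + s • v) (𝓝 0) (𝓝 (e x)) := by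
      simpa using hline.continuousAt.tendsto
    have hUe : e.symm ⁻¹' U ∈ 𝓝 (e x) := by
      refine (e.continuousAt_symm (e.map_source hx)).preimage_mem_nhds ?_
      rwa [e.left_inv hx]
    filter_upwards [htend hUe, htend (e.open_target.mem_nhds (e.map_source hx))] with s hs hs'
    refine hUc _ hs _ ?_ ?_
    · rw [e.left_inv hx]
      exact mem_of_mem_nhds hU
    · rw [e.right_inv hs', e.right_inv (e.map_source hx)]
      simp [hv0]
  have hgd' : HasFDerivAt g (fderiv ℝ g (e x)) (e x + (0 : ℝ) • v) := by
    rw [zero_smul, add_zero]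
    exact (mdifferentiableAt_iff_differentiableAt.mp hgd).hasFDerivAt
  have hderiv : HasDerivAt (fun s : ℝ => g (e x + s • v)) (fderiv ℝ g (e x) v) 0 :=
    hgd'.comp_hasDerivAt (f := fun s : ℝ => e x + s • v) (0 : ℝ) hline
  rw [hchain]
  exact hderiv.unique ((hasDerivAt_const (0 : ℝ) (g (e x))).congr_of_eventuallyEq hconst)

lemma mem_leafTangent_iff {e : OpenPartialHomeomorph M (Model (n + 1))} (he : e ∈ F.atlas) {x : M}
    (hx : x ∈ e.source) (w : TangentSpace (𝓡 (n + 1)) x) :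
    w ∈ F.leafTangent x ↔ transverseDifferential e x w = 0 := by
  simp only [leafTangent, Submodule.mem_iInf]
  exact ⟨fun h => h e ⟨he, hx⟩, fun h e' he' => transverseDifferential_eq_zero he he'.1 hx he'.2 h⟩

variable [IsManifold (𝓡 (n + 1)) ∞ M]
  [RiemannianBundle (fun x : M => TangentSpace (𝓡 (n + 1)) x)]

lemma transverseDifferential_normal_ne_zero (η : F.TransverseOrientation)
    {e : OpenPartialHomeomorph M (Model (n + 1))} (he : e ∈ F.atlas) {x : M}
    (hx : x ∈ e.source) :
    transverseDifferential e x (η.normal x) ≠ 0 := by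
  intro h
  have h1 := η.inner_normal x _ ((mem_leafTangent_iff he hx _).mpr h)
  rw [real_inner_self_eq_norm_sq, η.norm_normal] at h1
  norm_num at h1

/-- The differential of a transverse coordinate `t` is `dt = dt(η) ⟨η, ·⟩`. -/
lemma transverseDifferential_eq (η : F.TransverseOrientation)
    {e : OpenPartialHomeomorph M (Model (n + 1))} (he : e ∈ F.atlas) {x : M}
    (hx : x ∈ e.source) (v : TangentSpace (𝓡 (n + 1)) x) :
    transverseDifferential e x v =
      transverseDifferential e x (η.normal x) * inner ℝ (η.normal x) v := by
  set D := transverseDifferential e x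
  have ha : D (η.normal x) ≠ 0 := transverseDifferential_normal_ne_zero η he hx
  have hmem : v - (D v / D (η.normal x)) • η.normal x ∈ F.leafTangent x := by
    rw [mem_leafTangent_iff he hx]
    rw [map_sub, map_smul, smul_eq_mul, div_mul_cancel₀ _ ha, sub_self]
  have h1 := η.inner_normal x _ hmem
  rw [inner_sub_right, real_inner_smul_right, real_inner_self_eq_norm_sq, η.norm_normal,
    sub_eq_zero] at h1
  rw [h1]
  field_simp

lemma mem_leafTangent_iff_inner (η : F.TransverseOrientation) (x : M)
    (v : TangentSpace (𝓡 (n + 1)) x) : v ∈ F.leafTangent x ↔ inner ℝ (η.normal x) v = 0 := by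
  obtain ⟨e, he, hx⟩ := F.cover x
  rw [mem_leafTangent_iff he hx, transverseDifferential_eq η he hx,
    mul_eq_zero_iff_left (transverseDifferential_normal_ne_zero η he hx)]

lemma continuousOn_fieldInChart (η : F.TransverseOrientation) (p : M) :
    ContinuousOn (fieldInChart η.normal p) (chartAt (Model (n + 1)) p).target := by
  set e := trivializationAt (Model (n + 1)) (TangentSpace (𝓡 (n + 1))) p with he
  have hbase : e.baseSet = (chartAt (Model (n + 1)) p).source := by simp [he]
  have hmaps : Set.MapsTo (fun y => (⟨(chartAt (Model (n + 1)) p).symm y,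
      η.normal ((chartAt (Model (n + 1)) p).symm y)⟩ : TangentBundle (𝓡 (n + 1)) M))
      (chartAt (Model (n + 1)) p).target e.source := fun y hy => by
    rw [e.mem_source, hbase]
    exact (chartAt (Model (n + 1)) p).map_target hy
  have hcont := continuous_snd.comp_continuousOn (e.continuousOn.comp
    (η.continuous_normal.comp_continuousOn (chartAt (Model (n + 1)) p).continuousOn_symm) hmaps)
  refine hcont.congr fun y hy => ?_
  have hy' : (chartAt (Model (n + 1)) p).symm y ∈ e.baseSet := by
    rw [hbase]
    exact (chartAt (Model (n + 1)) p).map_target hy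
  exact e.continuousLinearMapAt_apply_of_mem (R := ℝ) hy' _

variable [IsContMDiffRiemannianBundle (𝓡 (n + 1)) ∞ (Model (n + 1))
  (fun x : M => TangentSpace (𝓡 (n + 1)) x)]

/-- A continuous unit normal field of a `C²` foliation is `C¹`: with the transverse coordinate `t`
and its gradient `W`, it is `± W / √(dt(W))` with a locally constant sign. -/
lemma contDiffOn_fieldInChart (η : F.TransverseOrientation) (p : M) :
    ContDiffOn ℝ 1 (fieldInChart η.normal p) (chartAt (Model (n + 1)) p).target := by
  intro y₀ hy₀
  refine ContDiffAt.contDiffWithinAt ?_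
  set φ := chartAt (Model (n + 1)) p
  set X := fieldInChart η.normal p
  obtain ⟨e, he, hq₀⟩ := F.cover (φ.symm y₀)
  set t : Model (n + 1) → ℝ := fun y => transverse e (φ.symm y)
  have hO : ∀ᶠ y in 𝓝 y₀, y ∈ φ.target ∧ φ.symm y ∈ e.source :=
    Filter.inter_mem (φ.open_target.mem_nhds hy₀)
      ((φ.continuousAt_symm hy₀).preimage_mem_nhds (e.open_source.mem_nhds hq₀))
  have ht : ContDiffAt ℝ 2 t y₀ := by
    have h1 : ContMDiffAt (𝓡 (n + 1)) 𝓘(ℝ, ℝ) 2 (transverse e) (φ.symm y₀) :=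
      (contMDiffOn_transverse he).contMDiffAt (e.open_source.mem_nhds hq₀)
    have h2 : ContMDiffAt (𝓡 (n + 1)) (𝓡 (n + 1)) 2 φ.symm y₀ :=
      (contMDiffOn_chart_symm (x := p)).contMDiffAt (φ.open_target.mem_nhds hy₀)
    exact (h1.comp y₀ h2).contDiffAt
  have hdt : ContDiffAt ℝ 1 (fderiv ℝ t) y₀ := ht.fderiv_right (by norm_num)
  set a : Model (n + 1) → ℝ := fun y => fderiv ℝ t y (X y)
  have hframe : ∀ y, y ∈ φ.target → φ.symm y ∈ e.source → ∀ v,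
      transverseDifferential e (φ.symm y) (frame p (φ.symm y) v) = fderiv ℝ t y v := by
    intro y hy hye v
    have h := mfderiv_frame (φ.map_target hy) (mdifferentiableAt_transverse he hye) v
    rw [φ.right_inv hy] at h
    exact h
  have hX : ∀ y ∈ φ.target, frame p (φ.symm y) (X y) = η.normal (φ.symm y) := fun y hy =>
    frame_coords (φ.map_target hy) _
  have ha : ∀ y, y ∈ φ.target → φ.symm y ∈ e.source → a y ≠ 0 := by
    intro y hy hye
    have h := transverseDifferential_normal_ne_zero η he hye
    rwa [← hX y hy, hframe y hy hye] at h
  -- the gradient of `t` in coordinates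
  set W : Model (n + 1) → Model (n + 1) := fun y => WithLp.toLp 2 fun i =>
    ∑ j, (metricMatrix p y)⁻¹ i j * fderiv ℝ t y (EuclideanSpace.single j 1)
  have hW : ∀ y, y ∈ φ.target → φ.symm y ∈ e.source → W y = a y • X y := by
    intro y hy hye
    have hdet := (metricMatrix_posDef hy).det_pos.ne'
    have h1 : ∀ j, fderiv ℝ t y (EuclideanSpace.single j 1) =
        a y * ∑ k, metricMatrix p y j k * X y k := by
      intro j
      have h := transverseDifferential_eq η he hye
        (frame p (φ.symm y) (EuclideanSpace.single j 1))
      rw [← hX y hy, hframe y hy hye, hframe y hy hye, inner_frame] at h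
      rw [h]
      congr 1
      refine Finset.sum_congr rfl fun k _ => ?_
      rw [Finset.sum_eq_single j]
      · simp [metricMatrix_symm p y k j]
      · intro l _ hl
        simp [hl]
      · simp
    have h2 : (fun j => fderiv ℝ t y (EuclideanSpace.single j 1)) =
        a y • (metricMatrix p y).mulVec (X y) := by
      ext j
      rw [h1 j]
      rfl
    have h3 : (metricMatrix p y)⁻¹.mulVec
        (fun j => fderiv ℝ t y (EuclideanSpace.single j 1)) = a y • (X y).ofLp := by
      rw [h2, Matrix.mulVec_smul, Matrix.mulVec_mulVec,
        Matrix.nonsing_inv_mul _ hdet.isUnit, Matrix.one_mulVec]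
    ext i
    exact congrFun h3 i
  have hWd : ContDiffAt ℝ 1 W y₀ := by
    refine contDiffAt_euclidean.mpr fun i => ?_
    change ContDiffAt ℝ 1 (fun y => ∑ j, (metricMatrix p y)⁻¹ i j *
      fderiv ℝ t y (EuclideanSpace.single j 1)) y₀
    refine ContDiffAt.sum fun j _ => ?_
    exact ((contDiffAt_inv_apply (contDiffAt_metricMatrix hy₀)
      (metricMatrix_posDef hy₀).det_pos.ne' i j).of_le (by norm_num)).mul
        (hdt.clm_apply contDiffAt_const)
  set b : Model (n + 1) → ℝ := fun y => fderiv ℝ t y (W y)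
  have hb : ∀ y, y ∈ φ.target → φ.symm y ∈ e.source → b y = a y ^ 2 := by
    intro y hy hye
    simp only [b, hW y hy hye, map_smul, smul_eq_mul, a]
    ring
  have hsqrt : ContDiffAt ℝ 1 (fun y => Real.sqrt (b y)) y₀ := by
    refine (hdt.clm_apply hWd).sqrt ?_
    change b y₀ ≠ 0
    rw [hb y₀ hy₀ hq₀]
    exact pow_ne_zero 2 (ha y₀ hy₀ hq₀)
  have hacont : ContinuousAt a y₀ := hdt.continuousAt.clm_apply
    ((continuousOn_fieldInChart η p).continuousAt (φ.open_target.mem_nhds hy₀))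
  -- `a` is continuous without zeros and `a² = b`, so `a = ± √b` near `y₀`
  have had : ContDiffAt ℝ 1 a y₀ := by
    rcases lt_or_gt_of_ne (ha y₀ hy₀ hq₀) with hneg | hpos
    · refine hsqrt.neg.congr_of_eventuallyEq ?_
      filter_upwards [hO, hacont.eventually_lt_const hneg] with y hy hlt
      rw [hb y hy.1 hy.2, Real.sqrt_sq_eq_abs, abs_of_neg hlt, neg_neg]
    · refine hsqrt.congr_of_eventuallyEq ?_
      filter_upwards [hO, hacont.eventually_const_lt hpos] with y hy hlt
      rw [hb y hy.1 hy.2, Real.sqrt_sq hlt.le]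
  refine ((had.inv (ha y₀ hy₀ hq₀)).smul hWd).congr_of_eventuallyEq ?_
  filter_upwards [hO] with y hy
  rw [Pi.smul_apply', Pi.inv_apply, hW y hy.1 hy.2, smul_smul, inv_mul_cancel₀ (ha y hy.1 hy.2),
    one_smul]

/-- The mean curvature of the leaves is minus the trace of `∇η`, since `⟨∇_η η, η⟩ = 0`. -/
lemma trace_leviCivita_normal (η : F.TransverseOrientation) (x : M) :
    LinearMap.trace ℝ (TangentSpace (𝓡 (n + 1)) x) (leviCivita η.normal x).toLinearMap =
      -meanCurvature η x := by
  have : FiniteDimensional ℝ (TangentSpace (𝓡 (n + 1)) x) :=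
    inferInstanceAs (FiniteDimensional ℝ (Model (n + 1)))
  have hd : DifferentiableAt ℝ (fieldInChart η.normal x) (chartAt (Model (n + 1)) x x) :=
    ((contDiffOn_fieldInChart η x).contDiffAt ((chartAt (Model (n + 1)) x).open_target.mem_nhds
      (mem_chart_target _ x))).differentiableAt one_ne_zero
  have h := trace_compression (η.norm_normal x) (mem_leafTangent_iff_inner η x)
    (leviCivita η.normal x)
  rw [real_inner_comm, inner_leviCivita_self η.normal x hd η.norm_normal, sub_zero] at h
  rw [← h, meanCurvature, shapeOperator, ContinuousLinearMap.toLinearMap_neg, map_neg, neg_neg]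

end Foliation

/-! ### The divergence theorem for a field of constant divergence -/

section DirectionalDerivative

variable {d : ℕ} {M : Type*} [TopologicalSpace M] [ChartedSpace (Model d) M]

/-- The derivative `dψ(X)` of a function along a vector field. -/
def derivAlong (X : Π q : M, TangentSpace (𝓡 d) q) (ψ : M → ℝ) (x : M) : ℝ :=
  mfderiv (𝓡 d) 𝓘(ℝ, ℝ) ψ x (X x)

lemma derivAlong_add (X : Π q : M, TangentSpace (𝓡 d) q) {φ ψ : M → ℝ} {x : M}
    (hφ : MDifferentiableAt (𝓡 d) 𝓘(ℝ, ℝ) φ x) (hψ : MDifferentiableAt (𝓡 d) 𝓘(ℝ, ℝ) ψ x) :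
    derivAlong X (fun z => φ z + ψ z) x = derivAlong X φ x + derivAlong X ψ x :=
  DFunLike.congr_fun (hφ.hasMFDerivAt.add hψ.hasMFDerivAt).mfderiv (X x)

lemma derivAlong_sum (X : Π q : M, TangentSpace (𝓡 d) q) {ι : Type*} (s : Finset ι)
    (ψ : ι → M → ℝ) (x : M) (hψ : ∀ i, MDifferentiableAt (𝓡 d) 𝓘(ℝ, ℝ) (ψ i) x) :
    derivAlong X (fun z => ∑ i ∈ s, ψ i z) x = ∑ i ∈ s, derivAlong X (ψ i) x := by
  classical
  suffices h : MDifferentiableAt (𝓡 d) 𝓘(ℝ, ℝ) (fun z => ∑ i ∈ s, ψ i z) x ∧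
      derivAlong X (fun z => ∑ i ∈ s, ψ i z) x = ∑ i ∈ s, derivAlong X (ψ i) x from h.2
  induction s using Finset.induction_on with
  | empty =>
    simp only [Finset.sum_empty]
    refine ⟨mdifferentiableAt_const, ?_⟩
    rw [derivAlong, mfderiv_const]
    rfl
  | insert i s hi IH =>
    simp only [Finset.sum_insert hi]
    exact ⟨(hψ i).add IH.1, by rw [derivAlong_add X (hψ i) IH.1, IH.2]⟩

lemma derivAlong_mul_self (X : Π q : M, TangentSpace (𝓡 d) q) {φ : M → ℝ} {x : M}
    (hφ : MDifferentiableAt (𝓡 d) 𝓘(ℝ, ℝ) φ x) :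
    derivAlong X (fun z => φ z * φ z) x = 2 * (φ x * derivAlong X φ x) := by
  have h := DFunLike.congr_fun (hφ.hasMFDerivAt.mul hφ.hasMFDerivAt).mfderiv (X x)
  have h2 : derivAlong X (fun z => φ z * φ z) x =
    φ x * derivAlong X φ x + φ x * derivAlong X φ x := h
  rw [h2]
  ring

lemma derivAlong_eq_zero_of_notMem_tsupport (X : Π q : M, TangentSpace (𝓡 d) q) {ψ : M → ℝ} {x : M}
    (hx : x ∉ tsupport ψ) : derivAlong X ψ x = 0 := by
  have h : ψ =ᶠ[𝓝 x] fun _ => 0 := by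
    filter_upwards [(isClosed_tsupport ψ).isOpen_compl.mem_nhds hx] with z hz
    exact image_eq_zero_of_notMem_tsupport hz
  rw [derivAlong, h.mfderiv_eq, mfderiv_const]
  rfl

/-- The coordinate expression of a function, extended by zero outside the chart. -/
def localExpression (p : M) (ψ : M → ℝ) : Model d → ℝ :=
  (chartAt (Model d) p).target.indicator fun y => ψ ((chartAt (Model d) p).symm y)

lemma isCompact_image_tsupport {p : M} {ψ : M → ℝ} (hc : HasCompactSupport ψ)
    (hsub : tsupport ψ ⊆ (chartAt (Model d) p).source) :
    IsCompact (chartAt (Model d) p '' tsupport ψ) :=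
  hc.isCompact.image_of_continuousOn ((chartAt (Model d) p).continuousOn.mono hsub)

lemma tsupport_localExpression_subset {p : M} {ψ : M → ℝ} (hc : HasCompactSupport ψ)
    (hsub : tsupport ψ ⊆ (chartAt (Model d) p).source) :
    tsupport (localExpression (d := d) p ψ) ⊆ chartAt (Model d) p '' tsupport ψ := by
  refine closure_minimal (fun y hy => ?_) (isCompact_image_tsupport hc hsub).isClosed
  have hy1 : y ∈ (chartAt (Model d) p).target := Set.mem_of_indicator_ne_zero hy
  refine ⟨(chartAt (Model d) p).symm y, subset_tsupport ψ ?_, (chartAt (Model d) p).right_inv hy1⟩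
  rwa [Function.mem_support, localExpression, Set.indicator_of_mem hy1] at hy

variable [IsManifold (𝓡 d) ∞ M]

lemma derivAlong_eq_fderiv (X : Π q : M, TangentSpace (𝓡 d) q) {ψ : M → ℝ} {p q : M}
    (hq : q ∈ (chartAt (Model d) p).source) (hψ : MDifferentiableAt (𝓡 d) 𝓘(ℝ, ℝ) ψ q) :
    derivAlong X ψ q = fderiv ℝ (fun y => ψ ((chartAt (Model d) p).symm y))
      (chartAt (Model d) p q) (fieldInChart X p (chartAt (Model d) p q)) := by
  rw [← mfderiv_frame hq hψ]
  have h : fieldInChart X p (chartAt (Model d) p q) = coords p q (X q) := by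
    unfold fieldInChart
    rw [(chartAt (Model d) p).left_inv hq]
  rw [h, frame_coords hq]
  rfl

lemma contDiffOn_comp_chart_symm {ψ : M → ℝ} (hψ : ContMDiff (𝓡 d) 𝓘(ℝ, ℝ) ∞ ψ) (p : M) :
    ContDiffOn ℝ ∞ (fun y => ψ ((chartAt (Model d) p).symm y)) (chartAt (Model d) p).target :=
  (hψ.comp_contMDiffOn (contMDiffOn_chart_symm (x := p))).contDiffOn

lemma continuous_derivAlong {X : Π q : M, TangentSpace (𝓡 d) q}
    (hX : ∀ p, ContinuousOn (fieldInChart X p) (chartAt (Model d) p).target) {ψ : M → ℝ}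
    (hψ : ContMDiff (𝓡 d) 𝓘(ℝ, ℝ) ∞ ψ) : Continuous (derivAlong X ψ) := by
  rw [continuous_iff_continuousAt]
  intro p
  have hcont : ContinuousOn (fun y => fderiv ℝ (fun y => ψ ((chartAt (Model d) p).symm y)) y
      (fieldInChart X p y)) (chartAt (Model d) p).target :=
    ((contDiffOn_comp_chart_symm hψ p).continuousOn_fderiv_of_isOpen
      (chartAt (Model d) p).open_target (by simp)).clm_apply (hX p)
  have hcomp := hcont.comp (chartAt (Model d) p).continuousOn (chartAt (Model d) p).mapsTo
  have hon : ContinuousOn (derivAlong X ψ) (chartAt (Model d) p).source :=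
    hcomp.congr fun q hq => derivAlong_eq_fderiv X hq (hψ.mdifferentiable (by simp) q)
  exact hon.continuousAt ((chartAt (Model d) p).open_source.mem_nhds (mem_chart_source _ p))

lemma contDiff_localExpression {p : M} {ψ : M → ℝ} (hψ : ContMDiff (𝓡 d) 𝓘(ℝ, ℝ) ∞ ψ)
    (hc : HasCompactSupport ψ) (hsub : tsupport ψ ⊆ (chartAt (Model d) p).source) :
    ContDiff ℝ ∞ (localExpression (d := d) p ψ) := by
  rw [contDiff_iff_contDiffAt]
  intro y
  by_cases hy : y ∈ (chartAt (Model d) p).target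
  · have hnhds := (chartAt (Model d) p).open_target.mem_nhds hy
    refine ((contDiffOn_comp_chart_symm hψ p).contDiffAt hnhds).congr_of_eventuallyEq ?_
    filter_upwards [hnhds] with z hz using Set.indicator_of_mem hz _
  · refine contDiffAt_const (c := (0 : ℝ)) |>.congr_of_eventuallyEq ?_
    have hy' : y ∉ tsupport (localExpression (d := d) p ψ) := fun h => by
      obtain ⟨q, hq, rfl⟩ := tsupport_localExpression_subset hc hsub h
      exact hy ((chartAt (Model d) p).map_source (hsub hq))
    filter_upwards [(isClosed_tsupport _).isOpen_compl.mem_nhds hy'] with z hz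
    exact image_eq_zero_of_notMem_tsupport hz

end DirectionalDerivative

section DivergenceTheorem

variable {d : ℕ} {M : Type*} [TopologicalSpace M]
  [MeasurableSpace M] [BorelSpace M] [ChartedSpace (Model d) M] [IsManifold (𝓡 d) ∞ M]
  [RiemannianBundle (fun x : M => TangentSpace (𝓡 d) x)]
  [IsContMDiffRiemannianBundle (𝓡 d) ∞ (Model d) (fun x : M => TangentSpace (𝓡 d) x)]

/-- Near a point where the trace of `∇X` is `-H`, the divergence theorem gives `∫ dψ(X) = H ∫ ψ` up
to a small error: in the chart centred at the point the divergence of `X` is continuous, and it is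
the trace of `∇X` at the centre. -/
lemma exists_nhds_abs_integral_derivAlong_sub_le {X : Π q : M, TangentSpace (𝓡 d) q} {H : ℝ}
    (p : M) (hX : ContDiffOn ℝ 1 (fieldInChart X p) (chartAt (Model d) p).target)
    (hXc : ∀ p, ContinuousOn (fieldInChart X p) (chartAt (Model d) p).target)
    (htr : LinearMap.trace ℝ (TangentSpace (𝓡 d) p) (leviCivita X p).toLinearMap = -H)
    {ε : ℝ} (hε : 0 < ε) :
    ∃ V : Set M, IsOpen V ∧ p ∈ V ∧ ∀ ψ : M → ℝ, ContMDiff (𝓡 d) 𝓘(ℝ, ℝ) ∞ ψ →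
      HasCompactSupport ψ → tsupport ψ ⊆ V → (∀ x, 0 ≤ ψ x) →
      |∫ x, derivAlong X ψ x ∂(riemannianVolume d M) - H * ∫ x, ψ x ∂(riemannianVolume d M)| ≤
        ε * ∫ x, ψ x ∂(riemannianVolume d M) := by
  set φ := chartAt (Model d) p
  set Y : Model d → Model d := fun y => density p y • fieldInChart X p y
  have hYd : ContDiffOn ℝ 1 Y φ.target := ((contDiffOn_density p).of_le (by simp)).smul hX
  have hp : φ p ∈ φ.target := mem_chart_target _ p
  have hdivc : ContinuousOn (divergence Y) φ.target := continuousOn_divergence φ.open_target hYd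
  have hdens : ContinuousOn (density (d := d) p) φ.target := (contDiffOn_density p).continuousOn
  have hquot : ContinuousOn (fun y => divergence Y y / density p y + H) φ.target :=
    (hdivc.div hdens fun y hy => (density_pos hy).ne').add continuousOn_const
  have hzero : divergence Y (φ p) / density p (φ p) + H = 0 := by
    have h := divergence_density_smul X p
      ((hX.contDiffAt (φ.open_target.mem_nhds hp)).differentiableAt one_ne_zero)
    rw [htr] at h
    change divergence Y (φ p) = density p (φ p) * -H at h
    rw [h, mul_div_cancel_left₀ _ (density_pos hp).ne']
    ring
  have hev : ∀ᶠ y in 𝓝 (φ p), |divergence Y y / density p y + H| < ε := by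
    have h := (hquot.continuousAt (φ.open_target.mem_nhds hp)).abs
    refine h.eventually_lt_const ?_
    simpa only [hzero, abs_zero] using hε
  obtain ⟨O, hO, hOo, hpO⟩ := eventually_nhds_iff.mp hev
  refine ⟨φ.source ∩ φ ⁻¹' O, φ.continuousOn.isOpen_inter_preimage φ.open_source hOo,
    ⟨mem_chart_source _ p, hpO⟩, fun ψ hψ hc hsub hpos => ?_⟩
  have hsubs : tsupport ψ ⊆ φ.source := fun x hx => (hsub hx).1
  set u := localExpression (d := d) p ψ
  have hu : ContDiff ℝ ∞ u := contDiff_localExpression hψ hc hsubs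
  have hus : tsupport u ⊆ φ '' tsupport ψ := tsupport_localExpression_subset hc hsubs
  have huc : HasCompactSupport u :=
    (isCompact_image_tsupport hc hsubs).of_isClosed_subset (isClosed_tsupport u) hus
  have hut : tsupport u ⊆ φ.target := fun y hy => by
    obtain ⟨q, hq, rfl⟩ := hus hy
    exact φ.map_source (hsubs hq)
  have hueq : ∀ y ∈ φ.target, u y = ψ (φ.symm y) := fun y hy => Set.indicator_of_mem hy _
  have hI1 : ∫ x, ψ x ∂(riemannianVolume d M) = ∫ y, u y * density p y := by
    rw [integral_riemannianVolume p hψ.continuous fun x hx =>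
      image_eq_zero_of_notMem_tsupport fun h => hx (hsubs h)]
    rw [← setIntegral_eq_integral_of_forall_compl_eq_zero (s := φ.target) (μ := volume)
      (f := fun y => u y * density p y)]
    · refine setIntegral_congr_fun φ.open_target.measurableSet fun y hy => ?_
      simp only [hueq y hy, mul_comm, φ]
    · intro y hy
      rw [image_eq_zero_of_notMem_tsupport fun h => hy (hut h), zero_mul]
  have hI2 : ∫ x, derivAlong X ψ x ∂(riemannianVolume d M) = -∫ y, u y * divergence Y y := by
    rw [← integral_fderiv_apply_eq_neg_integral_mul_divergence φ.open_target
      (hu.of_le (by simp)) huc hut hYd, integral_riemannianVolume p (continuous_derivAlong hXc hψ)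
      fun x hx => derivAlong_eq_zero_of_notMem_tsupport X fun h => hx (hsubs h)]
    rw [← setIntegral_eq_integral_of_forall_compl_eq_zero (s := φ.target) (μ := volume)
      (f := fun y => fderiv ℝ u y (Y y))]
    · refine setIntegral_congr_fun φ.open_target.measurableSet fun y hy => ?_
      have hloc : u =ᶠ[𝓝 y] fun z => ψ (φ.symm z) := by
        filter_upwards [φ.open_target.mem_nhds hy] with z hz using hueq z hz
      have h := derivAlong_eq_fderiv X (φ.map_target hy)
        (hψ.mdifferentiable (by simp) (φ.symm y))
      rw [φ.right_inv hy] at h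
      simp only [hloc.fderiv_eq, Y, map_smul, smul_eq_mul]
      exact congrArg _ h
    · intro y hy
      have h0 : fderiv ℝ u y = 0 := by
        by_contra h'
        exact hy (hut (support_fderiv_subset ℝ h'))
      rw [h0]
      rfl
  have hint1 : Integrable fun y => u y * density p y :=
    integrable_mul_of_tsupport_subset φ.open_target hu.continuous huc hut hdens
  have hint2 : Integrable fun y => u y * divergence Y y :=
    integrable_mul_of_tsupport_subset φ.open_target hu.continuous huc hut hdivc
  rw [hI1, hI2, ← integral_neg, ← integral_const_mul, ← integral_const_mul,
    ← integral_sub hint2.fun_neg (hint1.const_mul H), ← Real.norm_eq_abs]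
  refine norm_integral_le_of_norm_le (hint1.const_mul ε) (Eventually.of_forall fun y => ?_)
  rw [Real.norm_eq_abs]
  by_cases hy : y ∈ tsupport u
  · have hyt := hut hy
    have hd := density_pos hyt
    have hu0 : 0 ≤ u y := by
      rw [hueq y hyt]
      exact hpos _
    have hyO : |divergence Y y / density p y + H| < ε := by
      obtain ⟨q, hq, rfl⟩ := hus hy
      exact hO _ (hsub hq).2
    have heq : -(u y * divergence Y y) - H * (u y * density p y) =
        -(u y * density p y * (divergence Y y / density p y + H)) := by
      field_simp
      ring
    rw [heq, abs_neg, abs_mul, abs_of_nonneg (mul_nonneg hu0 hd.le), mul_comm ε]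
    exact mul_le_mul_of_nonneg_left hyO.le (mul_nonneg hu0 hd.le)
  · rw [image_eq_zero_of_notMem_tsupport hy]
    simp

/-- The divergence theorem for a `C¹` vector field with `tr ∇X = -H` everywhere. -/
theorem integral_derivAlong_eq [T2Space M] [SecondCountableTopology M]
    {X : Π q : M, TangentSpace (𝓡 d) q} {H : ℝ}
    (hX : ∀ p, ContDiffOn ℝ 1 (fieldInChart X p) (chartAt (Model d) p).target)
    (htr : ∀ p, LinearMap.trace ℝ (TangentSpace (𝓡 d) p) (leviCivita X p).toLinearMap = -H)
    {ψ : M → ℝ} (hψ : ContMDiff (𝓡 d) 𝓘(ℝ, ℝ) ∞ ψ) (hc : HasCompactSupport ψ)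
    (hpos : ∀ x, 0 ≤ ψ x) :
    ∫ x, derivAlong X ψ x ∂(riemannianVolume d M) = H * ∫ x, ψ x ∂(riemannianVolume d M) := by
  have hXc := fun p => (hX p).continuousOn
  have : LocallyCompactSpace M := ChartedSpace.locallyCompactSpace (Model d) M
  have key : ∀ ε > 0, |∫ x, derivAlong X ψ x ∂(riemannianVolume d M) -
      H * ∫ x, ψ x ∂(riemannianVolume d M)| ≤ ε * ∫ x, ψ x ∂(riemannianVolume d M) := by
    intro ε hε
    choose V hVo hpV hV using fun p : M =>
      exists_nhds_abs_integral_derivAlong_sub_le p (hX p) hXc (htr p) hε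
    obtain ⟨ρ, hρ⟩ := SmoothPartitionOfUnity.exists_isSubordinate (𝓡 d) isClosed_univ V hVo
      fun x _ => Set.mem_iUnion.mpr ⟨x, hpV x⟩
    have hfin := ρ.locallyFinite.finite_nonempty_inter_compact hc.isCompact
    set S := hfin.toFinset
    set g : M → M → ℝ := fun i x => ρ i x * ψ x with hg
    have hgs : ∀ i, ContMDiff (𝓡 d) 𝓘(ℝ, ℝ) ∞ (g i) := fun i => (ρ i).contMDiff.mul hψ
    have hgc : ∀ i, HasCompactSupport (g i) := fun i => hc.mul_left
    have hsum : ψ = fun x => ∑ i ∈ S, g i x := by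
      ext x
      simp only [hg, ← Finset.sum_mul]
      by_cases hx : ψ x = 0
      · rw [hx, mul_zero]
      · have h1 : ∑ i ∈ S, ρ i x = 1 := by
          refine ρ.sum_finsupport' x (Set.mem_univ x) fun i hi => ?_
          rw [Set.Finite.mem_toFinset]
          exact ⟨x, (ρ.mem_finsupport x).mp hi, subset_tsupport ψ hx⟩
        rw [h1, one_mul]
    have hI1 : ∫ x, ψ x ∂(riemannianVolume d M) =
        ∑ i ∈ S, ∫ x, g i x ∂(riemannianVolume d M) := by
      conv_lhs => rw [hsum]
      exact integral_finsetSum _ fun i _ =>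
        (hgs i).continuous.integrable_of_hasCompactSupport (hgc i)
    have hI2 : ∫ x, derivAlong X ψ x ∂(riemannianVolume d M) =
        ∑ i ∈ S, ∫ x, derivAlong X (g i) x ∂(riemannianVolume d M) := by
      rw [← integral_finsetSum]
      · refine integral_congr_ae (Eventually.of_forall fun x => ?_)
        simp only
        rw [← derivAlong_sum X S g x fun i => (hgs i).mdifferentiable (by simp) x, ← hsum]
      · intro i _
        refine (continuous_derivAlong hXc (hgs i)).integrable_of_hasCompactSupport
          ((hgc i).mono' fun x hx => ?_)
        by_contra h
        exact hx (derivAlong_eq_zero_of_notMem_tsupport X h)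
    rw [hI1, hI2, Finset.mul_sum, Finset.mul_sum, ← Finset.sum_sub_distrib]
    refine (Finset.abs_sum_le_sum_abs _ _).trans (Finset.sum_le_sum fun i _ => ?_)
    exact hV i (g i) (hgs i) (hgc i) (tsupport_mul_subset_left.trans (hρ i))
      fun x => mul_nonneg (ρ.nonneg i x) (hpos x)
  have hlim : |∫ x, derivAlong X ψ x ∂(riemannianVolume d M) -
      H * ∫ x, ψ x ∂(riemannianVolume d M)| ≤ 0 := by
    have htend : Tendsto (fun ε : ℝ => ε * ∫ x, ψ x ∂(riemannianVolume d M)) (𝓝[>] 0) (𝓝 0) := by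
      have h : Tendsto (fun ε : ℝ => ε * ∫ x, ψ x ∂(riemannianVolume d M)) (𝓝 0)
          (𝓝 (0 * ∫ x, ψ x ∂(riemannianVolume d M))) := tendsto_id.mul_const _
      rw [zero_mul] at h
      exact h.mono_left nhdsWithin_le_nhds
    exact ge_of_tendsto htend (eventually_nhdsWithin_of_forall key)
  exact sub_eq_zero.mp (abs_nonpos_iff.mp hlim)

end DivergenceTheorem

/-! ### The lower bound for the fundamental tone -/

section FundamentalTone

variable {d : ℕ} {M : Type*} [TopologicalSpace M] [ChartedSpace (Model d) M]
  [RiemannianBundle (fun x : M => TangentSpace (𝓡 d) x)]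

lemma abs_derivAlong_le_norm_grad {X : Π q : M, TangentSpace (𝓡 d) q} (hX : ∀ q, ‖X q‖ = 1)
    (φ : M → ℝ) (x : M) : |derivAlong X φ x| ≤ ‖grad (d := d) φ x‖ := by
  have : FiniteDimensional ℝ (TangentSpace (𝓡 d) x) :=
    inferInstanceAs (FiniteDimensional ℝ (Model d))
  have : CompleteSpace (TangentSpace (𝓡 d) x) := FiniteDimensional.complete ℝ _
  have h : inner ℝ (grad (d := d) φ x) (X x) = derivAlong X φ x :=
    InnerProductSpace.toDual_symm_apply
  rw [← h]
  simpa [hX] using abs_real_inner_le_norm (grad (d := d) φ x) (X x)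

variable [IsManifold (𝓡 d) ∞ M] [MeasurableSpace M] [BorelSpace M]

lemma eLpNorm_two_eq {α : Type*} [MeasurableSpace α] (g : α → ℝ) (μ : Measure α) :
    eLpNorm g 2 μ = (∫⁻ x, ‖g x‖ₑ ^ 2 ∂μ) ^ (1 / 2 : ℝ) := by
  simp [eLpNorm_eq_lintegral_rpow_enorm_toReal two_ne_zero ENNReal.ofNat_ne_top]

/-- An inequality `c ∫ φ² ≤ ∫ |∇φ|²` for test functions extends to `H₀¹(M)`. -/
lemma mul_lintegral_le_energy {c : ℝ≥0∞} (hc : c ≠ ⊤)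
    (hcφ : ∀ φ : M → ℝ, IsTestFunction d φ → c * ∫⁻ x, ‖φ x‖ₑ ^ 2 ∂(riemannianVolume d M) ≤
      ∫⁻ x, ‖grad (d := d) φ x‖ₑ ^ 2 ∂(riemannianVolume d M))
    {f : M → ℝ} {D : ℝ≥0∞} (hf : IsSobolevWithEnergy d f D) :
    c * ∫⁻ x, ‖f x‖ₑ ^ 2 ∂(riemannianVolume d M) ≤ D := by
  set μ := riemannianVolume d M
  obtain ⟨hmem, φ, hφ, hL2, -, hD⟩ := hf
  have hφc : ∀ k, AEStronglyMeasurable (φ k) μ := fun k =>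
    (hφ k).1.continuous.aestronglyMeasurable
  have hrpow : Continuous fun t : ℝ≥0∞ => t ^ (1 / 2 : ℝ) := ENNReal.continuous_rpow_const
  have hle : ∀ k, c ^ (1 / 2 : ℝ) * eLpNorm f 2 μ ≤
      c ^ (1 / 2 : ℝ) * (∫⁻ x, ‖φ k x - f x‖ₑ ^ 2 ∂μ) ^ (1 / 2 : ℝ) +
        (∫⁻ x, ‖grad (d := d) (φ k) x‖ₑ ^ 2 ∂μ) ^ (1 / 2 : ℝ) := by
    intro k
    have h1 : eLpNorm f 2 μ ≤ eLpNorm (φ k - f) 2 μ + eLpNorm (φ k) 2 μ := by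
      rw [eLpNorm_sub_comm]
      have h := eLpNorm_add_le (hmem.1.sub (hφc k)) (hφc k) one_le_two
      rwa [sub_add_cancel] at h
    have h2 := ENNReal.rpow_le_rpow (hcφ (φ k) (hφ k)) (z := 1 / 2) (by norm_num)
    rw [ENNReal.mul_rpow_of_nonneg _ _ (by norm_num), ← eLpNorm_two_eq] at h2
    have h3 := eLpNorm_two_eq (φ k - f) μ
    simp only [Pi.sub_apply] at h3
    rw [← h3]
    calc c ^ (1 / 2 : ℝ) * eLpNorm f 2 μ
        ≤ c ^ (1 / 2 : ℝ) * (eLpNorm (φ k - f) 2 μ + eLpNorm (φ k) 2 μ) := by gcongr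
      _ ≤ _ := by
        rw [mul_add]
        gcongr
  have hzero : (0 : ℝ≥0∞) ^ (1 / 2 : ℝ) = 0 := ENNReal.zero_rpow_of_pos (by norm_num)
  have hlim : c ^ (1 / 2 : ℝ) * eLpNorm f 2 μ ≤ D ^ (1 / 2 : ℝ) := by
    have h1 := ENNReal.Tendsto.const_mul (a := c ^ (1 / 2 : ℝ)) ((hrpow.tendsto 0).comp hL2)
      (Or.inr (ENNReal.rpow_ne_top_of_nonneg (by norm_num) hc))
    have h2 := h1.add ((hrpow.tendsto D).comp hD)
    simp only [hzero, mul_zero, zero_add] at h2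
    exact ge_of_tendsto' h2 hle
  rw [eLpNorm_two_eq, ← ENNReal.mul_rpow_of_nonneg _ _ (by norm_num)] at hlim
  exact (ENNReal.rpow_le_rpow_iff (by norm_num)).mp hlim

/-- An inequality `c ∫ φ² ≤ ∫ |∇φ|²` for test functions bounds the fundamental tone below. -/
lemma le_fundamentalTone {c : ℝ≥0∞} (hc : c ≠ ⊤)
    (hcφ : ∀ φ : M → ℝ, IsTestFunction d φ → c * ∫⁻ x, ‖φ x‖ₑ ^ 2 ∂(riemannianVolume d M) ≤
      ∫⁻ x, ‖grad (d := d) φ x‖ₑ ^ 2 ∂(riemannianVolume d M)) :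
    c ≤ fundamentalTone d M := by
  refine le_iInf fun f => le_iInf fun D => le_iInf fun hf => le_iInf fun hne => ?_
  have h := mul_lintegral_le_energy hc hcφ hf
  refine (ENNReal.le_div_iff_mul_le (Or.inl ?_) (Or.inl ?_)).mpr h
  · intro h0
    rw [lintegral_eq_zero_iff' (hf.1.1.enorm.pow_const 2)] at h0
    refine hne (h0.mono fun x hx => ?_)
    simpa using hx
  · have h2 := hf.1.2
    rw [eLpNorm_two_eq] at h2
    intro htop
    rw [htop, ENNReal.top_rpow_of_pos (by norm_num)] at h2
    exact lt_irrefl _ h2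

variable [T2Space M] [SecondCountableTopology M]
  [IsContMDiffRiemannianBundle (𝓡 d) ∞ (Model d) (fun x : M => TangentSpace (𝓡 d) x)]

/-- The spectral inequality `(H² / 4) ∫ φ² ≤ ∫ |∇φ|²` for test functions, in a manifold with a unit
vector field of constant divergence `-H`. -/
lemma sq_mul_lintegral_le_lintegral_grad {X : Π q : M, TangentSpace (𝓡 d) q} {H : ℝ}
    (hX : ∀ p, ContDiffOn ℝ 1 (fieldInChart X p) (chartAt (Model d) p).target)
    (hnorm : ∀ q, ‖X q‖ = 1)
    (htr : ∀ p, LinearMap.trace ℝ (TangentSpace (𝓡 d) p) (leviCivita X p).toLinearMap = -H)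
    {φ : M → ℝ} (hφ : IsTestFunction d φ) :
    ENNReal.ofReal (H ^ 2 / 4) * ∫⁻ x, ‖φ x‖ₑ ^ 2 ∂(riemannianVolume d M) ≤
      ∫⁻ x, ‖grad (d := d) φ x‖ₑ ^ 2 ∂(riemannianVolume d M) := by
  rcases eq_or_ne H 0 with rfl | hH
  · simp
  obtain ⟨hs, hc⟩ := hφ
  set μ := riemannianVolume d M
  have hc0 : 0 < |H| := abs_pos.mpr hH
  have hmul : ∫ x, derivAlong X (fun z => φ z * φ z) x ∂μ = H * ∫ x, φ x * φ x ∂μ :=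
    integral_derivAlong_eq hX htr (hs.mul hs) hc.mul_left fun x => mul_self_nonneg _
  have hint : Integrable (fun x => φ x * φ x) μ :=
    (hs.continuous.mul hs.continuous).integrable_of_hasCompactSupport hc.mul_left
  have hsq : ∫⁻ x, ‖φ x‖ₑ ^ 2 ∂μ = ENNReal.ofReal (∫ x, φ x * φ x ∂μ) := by
    rw [ofReal_integral_eq_lintegral_ofReal hint (Eventually.of_forall fun x => mul_self_nonneg _)]
    refine lintegral_congr fun x => ?_
    rw [← enorm_pow, ← Real.enorm_of_nonneg (mul_self_nonneg (φ x)), sq]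
  -- weighted arithmetic-geometric mean inequality, with the weights that make `|H| / 2` appear
  have hpt : ∀ x, ‖derivAlong X (fun z => φ z * φ z) x‖ₑ ≤
      ENNReal.ofReal (|H| / 2) * ‖φ x‖ₑ ^ 2 +
        ENNReal.ofReal (2 / |H|) * ‖grad (d := d) φ x‖ₑ ^ 2 := by
    intro x
    rw [derivAlong_mul_self X (hs.mdifferentiable (by simp) x), Real.enorm_eq_ofReal_abs,
      Real.enorm_eq_ofReal_abs, ← ofReal_norm, ← ENNReal.ofReal_pow (abs_nonneg _),
      ← ENNReal.ofReal_pow (norm_nonneg _), ← ENNReal.ofReal_mul (by positivity),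
      ← ENNReal.ofReal_mul (by positivity), ← ENNReal.ofReal_add (by positivity) (by positivity)]
    refine ENNReal.ofReal_le_ofReal ?_
    have h1 := abs_derivAlong_le_norm_grad hnorm φ x
    rw [abs_mul, abs_mul, abs_two]
    refine (mul_le_mul_of_nonneg_left (mul_le_mul_of_nonneg_left h1 (abs_nonneg _))
      zero_le_two).trans ?_
    have h2 : |H| / 2 * |φ x| ^ 2 + 2 / |H| * ‖grad (d := d) φ x‖ ^ 2 -
        2 * (|φ x| * ‖grad (d := d) φ x‖) =
        (|H| * |φ x| - 2 * ‖grad (d := d) φ x‖) ^ 2 / (2 * |H|) := by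
      field_simp
      ring
    have h3 : 0 ≤ (|H| * |φ x| - 2 * ‖grad (d := d) φ x‖) ^ 2 / (2 * |H|) := by positivity
    linarith
  have hle : ENNReal.ofReal (|H| * ∫ x, φ x * φ x ∂μ) ≤
      ENNReal.ofReal (|H| / 2) * ∫⁻ x, ‖φ x‖ₑ ^ 2 ∂μ +
        ENNReal.ofReal (2 / |H|) * ∫⁻ x, ‖grad (d := d) φ x‖ₑ ^ 2 ∂μ := by
    have h1 : |H| * ∫ x, φ x * φ x ∂μ = ‖∫ x, derivAlong X (fun z => φ z * φ z) x ∂μ‖ := by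
      rw [hmul, norm_mul, Real.norm_eq_abs, Real.norm_of_nonneg
        (integral_nonneg fun x => mul_self_nonneg _)]
    rw [h1, ofReal_norm]
    refine (enorm_integral_le_lintegral_enorm _).trans ((lintegral_mono hpt).trans_eq ?_)
    have hm : Measurable fun x => ‖φ x‖ₑ ^ 2 := (hs.continuous.measurable.enorm).pow_const 2
    rw [lintegral_add_left (hm.const_mul _), lintegral_const_mul _ hm,
      lintegral_const_mul' _ _ ENNReal.ofReal_ne_top]
  set B := ∫⁻ x, ‖grad (d := d) φ x‖ₑ ^ 2 ∂μ
  rcases eq_or_ne B ⊤ with hB | hB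
  · rw [hB]
    exact le_top
  set A := ∫ x, φ x * φ x ∂μ
  have hA : 0 ≤ A := integral_nonneg fun x => mul_self_nonneg _
  rw [hsq] at hle ⊢
  obtain ⟨b, hb, hBb⟩ : ∃ b : ℝ, 0 ≤ b ∧ B = ENNReal.ofReal b :=
    ⟨B.toReal, ENNReal.toReal_nonneg, (ENNReal.ofReal_toReal hB).symm⟩
  rw [hBb, ← ENNReal.ofReal_mul (by positivity), ← ENNReal.ofReal_mul (by positivity),
    ← ENNReal.ofReal_add (by positivity) (by positivity),
    ENNReal.ofReal_le_ofReal_iff (by positivity)] at hle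
  rw [hBb, ← ENNReal.ofReal_mul (by positivity)]
  refine ENNReal.ofReal_le_ofReal ?_
  have h2 : |H| * (|H| * A) ≤ |H| * (|H| / 2 * A + 2 / |H| * b) :=
    mul_le_mul_of_nonneg_left hle hc0.le
  have h3 : |H| * (|H| / 2 * A + 2 / |H| * b) = |H| ^ 2 / 2 * A + 2 * b := by
    field_simp
  have h4 : |H| ^ 2 = H ^ 2 := sq_abs H
  nlinarith

end FundamentalTone

end FoliatedRiemannian

end

theorem corollary1p2 {n : ℕ} {M : Type*} [TopologicalSpace M] [T2Space M]
    [SecondCountableTopology M] [MeasurableSpace M] [BorelSpace M]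
    [ChartedSpace (FoliatedRiemannian.Model (n + 1)) M] [IsManifold (𝓡 (n + 1)) ∞ M]
    [RiemannianBundle (fun x : M => TangentSpace (𝓡 (n + 1)) x)]
    [IsContMDiffRiemannianBundle (𝓡 (n + 1)) ∞ (FoliatedRiemannian.Model (n + 1))
      (fun x : M => TangentSpace (𝓡 (n + 1)) x)]
    (hM : FoliatedRiemannian.fundamentalTone (n + 1) M = 0)
    (F : FoliatedRiemannian.Foliation n M) (η : F.TransverseOrientation)
    (hH : ∃ H : ℝ, ∀ L ∈ F.leaves, ∀ x ∈ L,
      FoliatedRiemannian.Foliation.meanCurvature η x = H) :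
    ∀ L ∈ F.leaves, FoliatedRiemannian.Foliation.IsMinimalLeaf η L := by
  obtain ⟨H, hH⟩ := hH
  have hHx : ∀ x, FoliatedRiemannian.Foliation.meanCurvature η x = H := fun x =>
    hH (F.leaf x) ⟨x, rfl⟩ x (Relation.EqvGen.refl x)
  have hbound := FoliatedRiemannian.le_fundamentalTone (M := M) ENNReal.ofReal_ne_top fun φ hφ =>
    FoliatedRiemannian.sq_mul_lintegral_le_lintegral_grad
      (FoliatedRiemannian.Foliation.contDiffOn_fieldInChart η) η.norm_normal (H := H)
      (fun p => by rw [FoliatedRiemannian.Foliation.trace_leviCivita_normal, hHx]) hφ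
  rw [hM, nonpos_iff_eq_zero, ENNReal.ofReal_eq_zero] at hbound
  have hH0 : H = 0 := by nlinarith [sq_nonneg H]
  intro L hL x hx
  rw [hH L hL x hx, hH0]
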